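/- **Setting.** Let $X\subseteq\mathbb R^d$, $Y\subseteq\mathbb R^n$ be closed convex sets and $f:X\times Y\to\mathbb R$ continuous, $\mu$-strongly convex in $x\in X$ for every $y\in Y$ and $\lambda$-strongly concave in $y\in Y$ for every $x\in X$ ($\mu,\lambda>0$; no smoothness is assumed). Put $m=\min\{\mu,\lambda\}$ and $\mathrm{Gap}(x,y)=\max_{y'\in Y}f(x,y')-\min_{x'\in X}f(x',y)$. Let $x_0\in X$, $y_0\in Y$, $\epsilon_0>0$ with $\mathrm{Gap}(x_0,y_0)\le\epsilon_0$. Let $\mathcal G_x(x,y;\xi)$, $\mathcal G_y(x,y;\xi)$ be stochastic subgradients: for all $(x,y)\in X\times Y$, $\mathbb E_\xi[\mathcal G_x(x,y;\xi)]$ is a subgradient of $f(\cdot,y)$ on $X$ at $x$, $\mathbb E_\xi[\mathcal G_y(x,y;\xi)]$ is a supergradient of $f(x,\cdot)$ on $Y$ at $y$, and, with constants $B_1,B_2>0$, $\mathbb E_\xi[\exp(\|\mathcal G_x(x,y;\xi)\|^2/B_1^2)]\le e$ and $\mathbb E_\xi[\exp(\|\mathcal G_y(x,y;\xi)\|^2/B_2^2)]\le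 e$. **Algorithm (Epoch-GDA).** Start from $x_0^1=x_0$, $y_0^1=y_0$ and parameters $\eta_x^1,\eta_y^1,R_1,T_1$. In epoch $k=1,\dots,K$, for $t=0,\dots,T_k-1$, with $\Pi_C$ the Euclidean projection onto $C$, $\mathcal B(c,R)$ the closed Euclidean ball, and independent samples $\xi_t^k$ with the law of $\xi$, $$x_{t+1}^k=\Pi_{X\cap\mathcal B(x_0^k,R_k)}\bigl(x_t^k-\eta_x^k\,\mathcal G_x(x_t^k,y_t^k;\xi_t^k)\bigr),\qquad y_{t+1}^k=\Pi_{Y\cap\mathcal B(y_0^k,R_k)}\bigl(y_t^k+\eta_y^k\,\mathcal G_y(x_t^k,y_t^k;\xi_t^k)\bigr).$$ Then $x_0^{k+1}=\bar x_k=\frac1{T_k}\sum_{t=0}^{T_k-1}x_t^k$, $y_0^{k+1}=\bar y_k=\frac1{T_k}\sum_{t=0}^{T_k-1}y_t^k$, and $\eta_x^{k+1}=\eta_x^k/2$, $\eta_y^{k+1}=\eta_y^k/2$, $R_{k+1}=R_k/\sqrt2$, $T_{k+1}=2T_k$. **Theorem.** Let $\delta\in(0,1)$, $\epsilon\in(0,1)$,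 $\epsilon<\epsilon_0$, $K=\lceil\log_2(\epsilon_0/\epsilon)\rceil$, $\tilde\delta=\delta/K$ and $$N=\max\bigl\{320^2(B_1+B_2)^2\cdot3\log(1/\tilde\delta),\ 3200\,(5+3\log(1/\tilde\delta))\max\{B_1^2,B_2^2\}\bigr\}.$$ Let $$R_1\ge 2\sqrt{2\epsilon_0/m},\qquad \eta_x^1=\frac{mR_1^2}{40(5+3\log(1/\tilde\delta))B_1^2},\qquad \eta_y^1=\frac{mR_1^2}{40(5+3\log(1/\tilde\delta))B_2^2},$$ and let $T_1$ be an integer with $T_1\ge N/(m^2R_1^2)$. Then: 1. With probability at least $1-\delta$, $\mathrm{Gap}(\bar x_K,\bar y_K)\le\frac{mR_1^2}{8\epsilon_0}\,\epsilon$. In particular, if $R_1=2\sqrt{2\epsilon_0/m}$, then with probability at least $1-\delta$, $\mathrm{Gap}(\bar x_K,\bar y_K)\le\epsilon$. 2. The total number of iterations $T_{tot}=\sum_{k=1}^KT_k$ satisfies $$T_{tot}\le\frac{N}{4m\epsilon}+\Bigl(T_1-\frac{N}{m^2R_1^2}\Bigr)\frac{2\epsilon_0}{\epsilon}.$$ In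 particular $T_{tot}\le\frac{N}{4m\epsilon}$ if $T_1=N/(m^2R_1^2)$, and $T_{tot}\le\frac{N}{4m\epsilon}+\frac{2\epsilon_0}{\epsilon}$ if $T_1=\lceil N/(m^2R_1^2)\rceil$. If $T_1=\lceil N/(m^2R_1^2)\rceil$ and $\epsilon_0\le(B_1+B_2)^2/m$, then $$T_{tot}\le 10^5\,\bigl(1+\log(K/\delta)\bigr)\frac{(B_1+B_2)^2}{m\,\epsilon}.$$ -/

import Mathlib

open MeasureTheory ProbabilityTheory

noncomputable section

/-- A minimizer of `g` over `S` (the minimizer, when it is unique). -/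
def argminOn {E : Type*} [Nonempty E] (g : E → ℝ) (S : Set E) : E :=
  Classical.epsilon fun a => a ∈ S ∧ IsMinOn g S a

/-- A maximizer of `g` over `S` (the maximizer, when it is unique). -/
def argmaxOn {E : Type*} [Nonempty E] (g : E → ℝ) (S : Set E) : E :=
  Classical.epsilon fun a => a ∈ S ∧ IsMaxOn g S a

/-- Euclidean projection onto `C`: the point of `C` closest to `z`
(it exists and is unique when `C` is nonempty, closed and convex). -/
def euclProj {d : ℕ} (C : Set (EuclideanSpace ℝ (Fin d))) (z : EuclideanSpace ℝ (Fin d)) :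
    EuclideanSpace ℝ (Fin d) :=
  argminOn (fun p => ‖p - z‖) C

/-- Duality gap `f (x, ŷ(x)) - f (x̂(y), y)`, where `ŷ(x)` maximizes `f (x, ·)` over `Y` and
`x̂(y)` minimizes `f (·, y)` over `X`. For `x ∈ X`, `y ∈ Y` both exist and are unique as soon as
`X`, `Y` are closed and `f` is continuous, strongly convex in `x` and strongly concave in `y`. -/
def dualityGap {d n : ℕ} (X : Set (EuclideanSpace ℝ (Fin d))) (Y : Set (EuclideanSpace ℝ (Fin n)))
    (f : EuclideanSpace ℝ (Fin d) → EuclideanSpace ℝ (Fin n) → ℝ)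
    (x : EuclideanSpace ℝ (Fin d)) (y : EuclideanSpace ℝ (Fin n)) : ℝ :=
  f x (argmaxOn (fun y' => f x y') Y) - f (argminOn (fun x' => f x' y) X) y

/-- `v` is a subgradient at `x` of the convex function `g` with domain `S`. -/
def IsSubgradientOn {d : ℕ} (S : Set (EuclideanSpace ℝ (Fin d)))
    (g : EuclideanSpace ℝ (Fin d) → ℝ) (x v : EuclideanSpace ℝ (Fin d)) : Prop :=
  ∀ z ∈ S, g x + inner ℝ v (z - x) ≤ g z

/-- `v` is a supergradient at `x` of the concave function `g` with domain `S`. -/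
def IsSupergradientOn {d : ℕ} (S : Set (EuclideanSpace ℝ (Fin d)))
    (g : EuclideanSpace ℝ (Fin d) → ℝ) (x v : EuclideanSpace ℝ (Fin d)) : Prop :=
  ∀ z ∈ S, g z ≤ g x + inner ℝ v (z - x)

/-- `E[exp (‖V‖² / B²)] ≤ exp 1` for a random vector `V` under the law `ν` (the expectation is a
Lebesgue integral in `[0, ∞]`, so it is in particular asserted to be finite). -/
def SubGaussianNorm {Ξ : Type*} [MeasurableSpace Ξ] {d : ℕ} (ν : Measure Ξ)
    (V : Ξ → EuclideanSpace ℝ (Fin d)) (B : ℝ) : Prop :=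
  ∫⁻ s, ENNReal.ofReal (Real.exp (‖V s‖ ^ 2 / B ^ 2)) ∂ν ≤ ENNReal.ofReal (Real.exp 1)

/-- The parameters of one epoch: step sizes, radius, number of iterations. -/
structure EpochParams where
  ηx : ℝ
  ηy : ℝ
  R : ℝ
  T : ℕ

/-- The parameters of the following epoch. -/
def EpochParams.next (p : EpochParams) : EpochParams where
  ηx := p.ηx / 2
  ηy := p.ηy / 2
  R := p.R / Real.sqrt 2
  T := 2 * p.T

/-- The parameters of epoch `k + 1` (epochs are numbered `1, 2, …`), from those of epoch `1`. -/
def epochParams (p : EpochParams) : ℕ → EpochParams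
  | 0 => p
  | k + 1 => (epochParams p k).next

/-- The iterate `(x_t, y_t)` of one epoch started at `(x0, y0)`: projected stochastic gradient
descent in `x` and ascent in `y`, `s t` being the sample drawn at step `t`. -/
def innerIterate {Ξ : Type*} {d n : ℕ}
    (X : Set (EuclideanSpace ℝ (Fin d))) (Y : Set (EuclideanSpace ℝ (Fin n)))
    (Gx : EuclideanSpace ℝ (Fin d) → EuclideanSpace ℝ (Fin n) → Ξ → EuclideanSpace ℝ (Fin d))
    (Gy : EuclideanSpace ℝ (Fin d) → EuclideanSpace ℝ (Fin n) → Ξ → EuclideanSpace ℝ (Fin n))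
    (p : EpochParams) (x0 : EuclideanSpace ℝ (Fin d)) (y0 : EuclideanSpace ℝ (Fin n))
    (s : ℕ → Ξ) : ℕ → EuclideanSpace ℝ (Fin d) × EuclideanSpace ℝ (Fin n)
  | 0 => (x0, y0)
  | t + 1 =>
    let z := innerIterate X Y Gx Gy p x0 y0 s t
    (euclProj (X ∩ Metric.closedBall x0 p.R) (z.1 - p.ηx • Gx z.1 z.2 (s t)),
      euclProj (Y ∩ Metric.closedBall y0 p.R) (z.2 + p.ηy • Gy z.1 z.2 (s t)))

/-- The averages `(x̄, ȳ)` of the iterates `t = 0, …, T - 1` of one epoch. -/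
def epochAverage {Ξ : Type*} {d n : ℕ}
    (X : Set (EuclideanSpace ℝ (Fin d))) (Y : Set (EuclideanSpace ℝ (Fin n)))
    (Gx : EuclideanSpace ℝ (Fin d) → EuclideanSpace ℝ (Fin n) → Ξ → EuclideanSpace ℝ (Fin d))
    (Gy : EuclideanSpace ℝ (Fin d) → EuclideanSpace ℝ (Fin n) → Ξ → EuclideanSpace ℝ (Fin n))
    (p : EpochParams) (x0 : EuclideanSpace ℝ (Fin d)) (y0 : EuclideanSpace ℝ (Fin n))
    (s : ℕ → Ξ) : EuclideanSpace ℝ (Fin d) × EuclideanSpace ℝ (Fin n) :=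
  ((1 / (p.T : ℝ)) • ∑ t ∈ Finset.range p.T, (innerIterate X Y Gx Gy p x0 y0 s t).1,
    (1 / (p.T : ℝ)) • ∑ t ∈ Finset.range p.T, (innerIterate X Y Gx Gy p x0 y0 s t).2)

/-- Epoch-GDA. `epochGDA … k` is the output `(x̄_k, ȳ_k)` of the `k`-th epoch, which is also the
starting point of epoch `k + 1`; for `k = 0` it is the initial point. `s k t` is the sample drawn
at step `t` of epoch `k + 1`. -/
def epochGDA {Ξ : Type*} {d n : ℕ}
    (X : Set (EuclideanSpace ℝ (Fin d))) (Y : Set (EuclideanSpace ℝ (Fin n)))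
    (Gx : EuclideanSpace ℝ (Fin d) → EuclideanSpace ℝ (Fin n) → Ξ → EuclideanSpace ℝ (Fin d))
    (Gy : EuclideanSpace ℝ (Fin d) → EuclideanSpace ℝ (Fin n) → Ξ → EuclideanSpace ℝ (Fin n))
    (p : EpochParams) (x0 : EuclideanSpace ℝ (Fin d)) (y0 : EuclideanSpace ℝ (Fin n))
    (s : ℕ → ℕ → Ξ) : ℕ → EuclideanSpace ℝ (Fin d) × EuclideanSpace ℝ (Fin n)
  | 0 => (x0, y0)
  | k + 1 =>
    let z := epochGDA X Y Gx Gy p x0 y0 s k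
    epochAverage X Y Gx Gy (epochParams p k) z.1 z.2 (s k)

/-- Total number of iterations performed in the first `K` epochs. -/
def totalIterations (p : EpochParams) (K : ℕ) : ℕ :=
  ∑ k ∈ Finset.range K, (epochParams p k).T

/-- The numerator `max {320² (B₁ + B₂)² · 3 log (1/δ'), 3200 (5 + 3 log (1/δ')) max {B₁², B₂²}}`
of the epoch length. -/
def epochConst (B₁ B₂ δ' : ℝ) : ℝ :=
  max (320 ^ 2 * (B₁ + B₂) ^ 2 * (3 * Real.log (1 / δ')))
    (3200 * (5 + 3 * Real.log (1 / δ')) * max (B₁ ^ 2) (B₂ ^ 2))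

end

/-!
In one epoch, convexity bounds the gap `f (x̄, b) - f (a, ȳ)` at fixed comparators `a`, `b` by the
regret of projected gradient descent. The noise enters the regret through inner products
`⟪noise, iterate - a⟫`, and the worst `a` depends on the samples. Following Nemirovski, a *ghost*
descent driven by the noise alone bounds `⟪noise, ghost - a⟫` deterministically and uniformly in
`a`; what is left, `⟪noise, iterate - ghost⟫`, is a martingale difference with sub-Gaussian
increments, so the total error `S` satisfies `E[exp S] ≤ 1` after scaling and centring, and Markov's
inequality bounds it outside an event of probability `δ'`.

Strong convexity turns a small gap at the centre of the balls into closeness of the centre to the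
best responses to `(x̄, ȳ)`. The best responses over the balls then lie in the interiors, hence are
global, and one epoch halves the bound `m R² / 8` on the gap. The parameters rescale with `R²`, so
the argument repeats, and a union bound over the epochs finishes the proof.
-/

section Average

variable {E : Type*} [AddCommGroup E] [Module ℝ E] {S : Set E} {T : ℕ} {u : ℕ → E}

theorem sum_range_one_div (hT : 0 < T) : ∑ _t ∈ Finset.range T, 1 / (T : ℝ) = 1 := by
  rw [Finset.sum_const, Finset.card_range, nsmul_eq_mul, mul_one_div_cancel (by positivity)]

theorem average_mem (hS : Convex ℝ S) (hT : 0 < T) (hu : ∀ t, u t ∈ S) :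
    (1 / (T : ℝ)) • ∑ t ∈ Finset.range T, u t ∈ S := by
  rw [Finset.smul_sum]
  exact hS.sum_mem (fun _ _ => by positivity) (sum_range_one_div hT) fun t _ => hu t

theorem mul_map_average_le {g : E → ℝ} (hg : ConvexOn ℝ S g) (hT : 0 < T) (hu : ∀ t, u t ∈ S) :
    T * g ((1 / (T : ℝ)) • ∑ t ∈ Finset.range T, u t) ≤ ∑ t ∈ Finset.range T, g (u t) := by
  have hjensen := hg.map_sum_le (t := Finset.range T) (w := fun _ => 1 / (T : ℝ)) (p := u)
    (fun _ _ => by positivity) (sum_range_one_div hT) fun t _ => hu t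
  rw [← Finset.smul_sum, ← Finset.smul_sum, smul_eq_mul, one_div_mul_eq_div,
    le_div_iff₀' (by positivity)] at hjensen
  exact hjensen

end Average

section EuclideanProjection

variable {d : ℕ} {C C' X : Set (EuclideanSpace ℝ (Fin d))} {w w' : EuclideanSpace ℝ (Fin d)}

theorem euclProj_spec (hC : IsClosed C) (hne : C.Nonempty) (z : EuclideanSpace ℝ (Fin d)) :
    euclProj C z ∈ C ∧ IsMinOn (fun p => ‖p - z‖) C (euclProj C z) := by
  refine Classical.epsilon_spec (p := fun a => a ∈ C ∧ IsMinOn (fun p => ‖p - z‖) C a) ?_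
  obtain ⟨a, ha, hdist⟩ := hC.exists_infDist_eq_dist hne z
  refine ⟨a, ha, isMinOn_iff.2 fun w hw => ?_⟩
  rw [← dist_eq_norm, ← dist_eq_norm, dist_comm a, dist_comm w, ← hdist]
  exact Metric.infDist_le_dist_of_mem hw

theorem euclProj_mem (hC : IsClosed C) (hne : C.Nonempty) (z : EuclideanSpace ℝ (Fin d)) :
    euclProj C z ∈ C :=
  (euclProj_spec hC hne z).1

theorem norm_sub_euclProj_le (hC : IsClosed C) (z : EuclideanSpace ℝ (Fin d)) (hw : w ∈ C) :
    ‖z - euclProj C z‖ ≤ ‖z - w‖ := by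
  rw [norm_sub_rev z, norm_sub_rev z]
  exact isMinOn_iff.1 (euclProj_spec hC ⟨w, hw⟩ z).2 w hw

theorem inner_sub_euclProj_le_zero (hC : IsClosed C) (hconv : Convex ℝ C)
    (z : EuclideanSpace ℝ (Fin d)) (hw : w ∈ C) :
    inner ℝ (z - euclProj C z) (w - euclProj C z) ≤ 0 := by
  have hmem : euclProj C z ∈ C := euclProj_mem hC ⟨w, hw⟩ z
  have : Nonempty C := ⟨w, hw⟩
  refine (norm_eq_iInf_iff_real_inner_le_zero hconv hmem).1 (le_antisymm ?_ ?_) w hw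
  · exact le_ciInf fun q => norm_sub_euclProj_le hC z q.2
  · exact ciInf_le (f := fun q : C => ‖z - q‖) ⟨0, Set.forall_mem_range.2 fun q => norm_nonneg _⟩
      ⟨_, hmem⟩

theorem norm_euclProj_sub_le (hC : IsClosed C) (hconv : Convex ℝ C)
    (z : EuclideanSpace ℝ (Fin d)) (hw : w ∈ C) : ‖euclProj C z - w‖ ≤ ‖z - w‖ := by
  have hinner := inner_sub_euclProj_le_zero hC hconv z hw
  have hsq : ‖z - w‖ ^ 2 = ‖z - euclProj C z‖ ^ 2
      - 2 * inner ℝ (z - euclProj C z) (w - euclProj C z) + ‖euclProj C z - w‖ ^ 2 := by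
    rw [norm_sub_rev (euclProj C z) w, ← norm_sub_sq_real, sub_sub_sub_cancel_right]
  refine le_of_sq_le_sq ?_ (norm_nonneg _)
  nlinarith [sq_nonneg ‖z - euclProj C z‖]

theorem inner_sub_euclProj_le (hC : IsClosed C) (hconv : Convex ℝ C)
    (z v : EuclideanSpace ℝ (Fin d)) (hw : w ∈ C) :
    inner ℝ (z - euclProj C z) (v - euclProj C z) ≤ ‖z - euclProj C z‖ * ‖w - v‖ := by
  rw [← sub_add_sub_cancel v w, inner_add_right, norm_sub_rev w v]
  linarith [inner_sub_euclProj_le_zero hC hconv z hw,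
    real_inner_le_norm (z - euclProj C z) (v - w)]

theorem norm_euclProj_sub_euclProj_sq_le (hC : IsClosed C) (hconv : Convex ℝ C)
    (hC' : IsClosed C') (hconv' : Convex ℝ C') (z z' : EuclideanSpace ℝ (Fin d)) {h : ℝ}
    (hw : w ∈ C) (hwh : ‖w - euclProj C' z'‖ ≤ h) (hw' : w' ∈ C') (hwh' : ‖w' - euclProj C z‖ ≤ h) :
    ‖euclProj C z - euclProj C' z'‖ ^ 2 ≤
      ‖z - z'‖ ^ 2 + 2 * h * (‖z - euclProj C z‖ + ‖z' - euclProj C' z'‖) := by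
  have hz := inner_sub_euclProj_le hC hconv z (euclProj C' z') hw
  have hz' := inner_sub_euclProj_le hC' hconv' z' (euclProj C z) hw'
  set q := euclProj C z
  set q' := euclProj C' z'
  have hsq : ‖z - z'‖ ^ 2 = ‖(z - q) - (z' - q')‖ ^ 2 - 2 * (inner ℝ (z - q) (q' - q)
      + inner ℝ (z' - q') (q - q')) + ‖q - q'‖ ^ 2 := by
    have hsplit : z - z' = ((z - q) - (z' - q')) + (q - q') := by abel
    rw [hsplit, norm_add_sq_real, inner_sub_left, ← neg_sub q q', inner_neg_right]
    ring
  have hqh := mul_le_mul_of_nonneg_left hwh (norm_nonneg (z - q))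
  have hqh' := mul_le_mul_of_nonneg_left hwh' (norm_nonneg (z' - q'))
  linarith [sq_nonneg ‖(z - q) - (z' - q')‖]

theorem exists_mem_inter_closedBall_norm_sub_le {E : Type*} [NormedAddCommGroup E]
    [NormedSpace ℝ E] {S : Set E} (hS : Convex ℝ S) {R : ℝ} (hR : 0 < R) {c c' q : E}
    (hc' : c' ∈ S) (hq : q ∈ S ∩ Metric.closedBall c R) :
    ∃ w ∈ S ∩ Metric.closedBall c' R, ‖w - q‖ ≤ ‖c - c'‖ := by
  have hpos : 0 < R + ‖c - c'‖ := by positivity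
  have hqc' : ‖q - c'‖ ≤ R + ‖c - c'‖ := by
    have hqc : ‖q - c‖ ≤ R := mem_closedBall_iff_norm.1 hq.2
    linarith [norm_sub_le_norm_sub_add_norm_sub q c c']
  set θ := R / (R + ‖c - c'‖) with hθ
  have hθ₀ : 0 ≤ θ := by positivity
  have hθ₁ : 1 - θ = ‖c - c'‖ / (R + ‖c - c'‖) := by
    rw [hθ, one_sub_div hpos.ne', add_sub_cancel_left]
  have hθ₁' : 0 ≤ 1 - θ := by rw [hθ₁]; positivity
  refine ⟨(1 - θ) • c' + θ • q, ⟨hS hc' hq.1 hθ₁' hθ₀ (by ring), ?_⟩, ?_⟩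
  · have hsub : (1 - θ) • c' + θ • q - c' = θ • (q - c') := by module
    rw [mem_closedBall_iff_norm, hsub, norm_smul, Real.norm_of_nonneg hθ₀]
    calc θ * ‖q - c'‖ ≤ θ * (R + ‖c - c'‖) := by gcongr
      _ = R := by rw [hθ]; field_simp
  · have hsub : (1 - θ) • c' + θ • q - q = (1 - θ) • (c' - q) := by module
    rw [hsub, norm_smul, Real.norm_of_nonneg hθ₁', norm_sub_rev]
    calc (1 - θ) * ‖q - c'‖ ≤ (1 - θ) * (R + ‖c - c'‖) := by gcongr
      _ = ‖c - c'‖ := by rw [hθ₁]; field_simp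

theorem norm_euclProj_inter_closedBall_sub_sq_le (hX : IsClosed X) (hconv : Convex ℝ X) {R : ℝ}
    (hR : 0 < R) {c c' : EuclideanSpace ℝ (Fin d)} (hc : c ∈ X) (hc' : c' ∈ X)
    (z z' : EuclideanSpace ℝ (Fin d)) :
    ‖euclProj (X ∩ Metric.closedBall c R) z - euclProj (X ∩ Metric.closedBall c' R) z'‖ ^ 2 ≤
      ‖z - z'‖ ^ 2 + 2 * ‖c - c'‖ * (‖z - c‖ + ‖z' - c'‖) := by
  have hcl : ∀ b, IsClosed (X ∩ Metric.closedBall b R) := fun b =>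
    hX.inter Metric.isClosed_closedBall
  have hcv : ∀ b, Convex ℝ (X ∩ Metric.closedBall b R) := fun b =>
    hconv.inter (convex_closedBall b R)
  have hself : ∀ b ∈ X, b ∈ X ∩ Metric.closedBall b R := fun b hb =>
    ⟨hb, Metric.mem_closedBall_self hR.le⟩
  obtain ⟨w, hw, hwq⟩ := exists_mem_inter_closedBall_norm_sub_le hconv hR hc
    (euclProj_mem (hcl c') ⟨c', hself c' hc'⟩ z')
  obtain ⟨w', hw', hwq'⟩ := exists_mem_inter_closedBall_norm_sub_le hconv hR hc'
    (euclProj_mem (hcl c) ⟨c, hself c hc⟩ z)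
  rw [norm_sub_rev c' c] at hwq
  refine (norm_euclProj_sub_euclProj_sq_le (hcl c) (hcv c) (hcl c') (hcv c') z z'
    hw hwq hw' hwq').trans ?_
  gcongr
  · exact norm_sub_euclProj_le (hcl c) z (hself c hc)
  · exact norm_sub_euclProj_le (hcl c') z' (hself c' hc')

theorem continuous_euclProj_inter_closedBall (hX : IsClosed X) (hconv : Convex ℝ X) {R : ℝ}
    (hR : 0 < R) :
    Continuous fun u : X × EuclideanSpace ℝ (Fin d) =>
      euclProj (X ∩ Metric.closedBall (u.1 : EuclideanSpace ℝ (Fin d)) R) u.2 := by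
  refine continuous_iff_continuousAt.2 fun u => tendsto_iff_norm_sub_tendsto_zero.2 ?_
  have hbound : Continuous fun v : X × EuclideanSpace ℝ (Fin d) =>
      √(‖v.2 - u.2‖ ^ 2 + 2 * ‖(v.1 : EuclideanSpace ℝ (Fin d)) - u.1‖
        * (‖v.2 - v.1‖ + ‖u.2 - u.1‖)) := by fun_prop
  refine squeeze_zero (fun _ => norm_nonneg _) (fun v => Real.le_sqrt_of_sq_le
    (norm_euclProj_inter_closedBall_sub_sq_le hX hconv hR v.1.2 u.1.2 v.2 u.2)) ?_
  simpa using hbound.tendsto u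

theorem measurable_euclProj_inter_closedBall {α : Type*} {mα : MeasurableSpace α}
    (hX : IsClosed X) (hconv : Convex ℝ X) {R : ℝ} (hR : 0 < R)
    {c z : α → EuclideanSpace ℝ (Fin d)} (hc : Measurable c) (hcX : ∀ a, c a ∈ X)
    (hz : Measurable z) :
    Measurable fun a => euclProj (X ∩ Metric.closedBall (c a) R) (z a) := by
  have hcomp := (continuous_euclProj_inter_closedBall hX hconv hR).measurable.comp
    ((hc.subtype_mk (h := hcX)).prodMk hz)
  exact hcomp

end EuclideanProjection

section ProjectedDescent

variable {d : ℕ} {C : Set (EuclideanSpace ℝ (Fin d))} {η : ℝ}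
  {u₀ w : EuclideanSpace ℝ (Fin d)}

/-- Projected (sub)gradient descent in `C` from `u₀` along the directions `g t`, with constant step
size `η`. -/
noncomputable def projDescent (C : Set (EuclideanSpace ℝ (Fin d))) (η : ℝ)
    (g : ℕ → EuclideanSpace ℝ (Fin d)) (u₀ : EuclideanSpace ℝ (Fin d)) :
    ℕ → EuclideanSpace ℝ (Fin d)
  | 0 => u₀
  | t + 1 => euclProj C (projDescent C η g u₀ t - η • g t)

theorem projDescent_mem (hC : IsClosed C) (g : ℕ → EuclideanSpace ℝ (Fin d)) (hu₀ : u₀ ∈ C) :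
    ∀ t, projDescent C η g u₀ t ∈ C
  | 0 => hu₀
  | _ + 1 => euclProj_mem hC ⟨u₀, hu₀⟩ _

theorem norm_euclProj_sub_smul_sub_sq_le (hC : IsClosed C) (hconv : Convex ℝ C)
    (u g : EuclideanSpace ℝ (Fin d)) (hw : w ∈ C) :
    2 * η * inner ℝ g (u - w) + ‖euclProj C (u - η • g) - w‖ ^ 2 ≤
      ‖u - w‖ ^ 2 + η ^ 2 * ‖g‖ ^ 2 := by
  have hproj : ‖euclProj C (u - η • g) - w‖ ^ 2 ≤ ‖u - η • g - w‖ ^ 2 := by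
    gcongr
    exact norm_euclProj_sub_le hC hconv _ hw
  have hsq : ‖u - η • g - w‖ ^ 2 =
      ‖u - w‖ ^ 2 - 2 * η * inner ℝ g (u - w) + η ^ 2 * ‖g‖ ^ 2 := by
    rw [sub_right_comm, norm_sub_sq_real, inner_smul_right, norm_smul, mul_pow, Real.norm_eq_abs,
      sq_abs, real_inner_comm]
    ring
  linarith

theorem sum_inner_projDescent_le (hC : IsClosed C) (hconv : Convex ℝ C)
    (g : ℕ → EuclideanSpace ℝ (Fin d)) (u₀ : EuclideanSpace ℝ (Fin d)) (hw : w ∈ C) (T : ℕ) :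
    2 * η * ∑ t ∈ Finset.range T, inner ℝ (g t) (projDescent C η g u₀ t - w) ≤
      ‖u₀ - w‖ ^ 2 + η ^ 2 * ∑ t ∈ Finset.range T, ‖g t‖ ^ 2 := by
  have telescoped : ∀ T, 2 * η * ∑ t ∈ Finset.range T, inner ℝ (g t) (projDescent C η g u₀ t - w)
      + ‖projDescent C η g u₀ T - w‖ ^ 2 ≤
      ‖u₀ - w‖ ^ 2 + η ^ 2 * ∑ t ∈ Finset.range T, ‖g t‖ ^ 2 := by
    intro T
    induction T with
    | zero => simp [projDescent]
    | succ T ih =>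
      have hstep : _ ≤ _ :=
        norm_euclProj_sub_smul_sub_sq_le (η := η) hC hconv (projDescent C η g u₀ T) (g T) hw
      rw [Finset.sum_range_succ, Finset.sum_range_succ, projDescent]
      linarith
  linarith [telescoped T, sq_nonneg ‖projDescent C η g u₀ T - w‖]

theorem measurable_projDescent {α : Type*} {mα : MeasurableSpace α}
    {X : Set (EuclideanSpace ℝ (Fin d))} (hX : IsClosed X) (hconv : Convex ℝ X) {R : ℝ} (hR : 0 < R)
    {c : α → EuclideanSpace ℝ (Fin d)} (hc : Measurable c) (hcX : ∀ a, c a ∈ X)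
    {g : ℕ → α → EuclideanSpace ℝ (Fin d)} {T : ℕ} (hg : ∀ t < T, Measurable (g t)) :
    Measurable fun a =>
      projDescent (X ∩ Metric.closedBall (c a) R) η (fun t => g t a) (c a) T := by
  induction T with
  | zero => exact hc
  | succ T ih =>
    exact measurable_euclProj_inter_closedBall hX hconv hR hc hcX
      ((ih fun t ht => hg t (ht.trans T.lt_succ_self)).sub ((hg T T.lt_succ_self).const_smul η))

-- A second ("ghost") descent along the errors `g' t - g t` absorbs their correlation with the
-- comparator `w`; what is left pairs each error with a difference that does not involve `w`.
theorem sum_inner_projDescent_le_of_estimate (hC : IsClosed C) (hconv : Convex ℝ C) (hη : 0 < η)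
    {B : ℝ} (g g' : ℕ → EuclideanSpace ℝ (Fin d)) (hg' : ∀ t, ‖g' t‖ ≤ B)
    (u₀ : EuclideanSpace ℝ (Fin d)) (hw : w ∈ C) (T : ℕ) :
    ∑ t ∈ Finset.range T, inner ℝ (g' t) (projDescent C η g u₀ t - w) ≤
      3 / (2 * η) * ‖u₀ - w‖ ^ 2 + ∑ t ∈ Finset.range T, (η * (‖g t‖ ^ 2 + B ^ 2 / 2)
        + inner ℝ (g' t - g t) (projDescent C η g u₀ t
          - projDescent C (η / 2) (fun t => g' t - g t) u₀ t)) := by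
  have hdescent := sum_inner_projDescent_le (η := η) hC hconv g u₀ hw T
  have hghost := sum_inner_projDescent_le (η := η / 2) hC hconv (fun t => g' t - g t) u₀ hw T
  set u := projDescent C η g u₀
  set ghost := projDescent C (η / 2) (fun t => g' t - g t) u₀
  have hsplit : ∀ t, inner ℝ (g' t) (u t - w) = inner ℝ (g t) (u t - w)
      + inner ℝ (g' t - g t) (ghost t - w) + inner ℝ (g' t - g t) (u t - ghost t) := fun t => by
    rw [add_assoc, ← inner_add_right, sub_add_sub_cancel', inner_sub_left]
    ring
  have herror : ∑ t ∈ Finset.range T, ‖g' t - g t‖ ^ 2 ≤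
      ∑ t ∈ Finset.range T, (2 * ‖g t‖ ^ 2 + 2 * B ^ 2) := by
    refine Finset.sum_le_sum fun t _ => ?_
    have : ‖g' t - g t‖ ^ 2 ≤ (B + ‖g t‖) ^ 2 := by
      gcongr
      exact (norm_sub_le _ _).trans (add_le_add_left (hg' t) _)
    nlinarith [sq_nonneg (B - ‖g t‖)]
  have herror' := mul_le_mul_of_nonneg_left herror (sq_nonneg η)
  refine le_of_mul_le_mul_left ?_ (by positivity : 0 < 2 * η)
  rw [mul_add, ← mul_assoc, mul_div_cancel₀ _ (by positivity)]
  simp only [hsplit, Finset.sum_add_distrib, ← Finset.mul_sum, ← Finset.sum_div]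
    at hdescent hghost herror' ⊢
  linarith

end ProjectedDescent

section StrongConvexity

variable {E : Type*} [NormedAddCommGroup E] [NormedSpace ℝ E] {S C : Set E} {g : E → ℝ} {m : ℝ}
  {x z : E}

theorem convexOn_of_strongConvexOn (hm : 0 ≤ m) (hg : StrongConvexOn S m g) : ConvexOn ℝ S g :=
  UniformConvexOn.convexOn hg fun r => by simp only [Pi.zero_apply]; positivity

theorem map_midpoint_le_of_strongConvexOn (hg : StrongConvexOn S m g) (hx : x ∈ S) (hz : z ∈ S) :
    g (midpoint ℝ x z) ≤ (g x + g z) / 2 - m / 8 * ‖x - z‖ ^ 2 := by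
  obtain ⟨-, hineq⟩ := hg
  have hhalf := hineq hx hz (a := 1 / 2) (b := 1 / 2) (by norm_num) (by norm_num) (by norm_num)
  have hmid : midpoint ℝ x z = (1 / 2 : ℝ) • x + (1 / 2 : ℝ) • z := by
    rw [midpoint_eq_smul_add, smul_add, invOf_eq_inv, one_div]
  simp only [smul_eq_mul, ← hmid] at hhalf
  linarith

theorem mul_norm_sub_sq_le_of_isMinOn (hg : StrongConvexOn S m g) (hCS : C ⊆ S) (hC : Convex ℝ C)
    (hx : x ∈ C) (hmin : IsMinOn g C x) (hz : z ∈ C) : m / 4 * ‖x - z‖ ^ 2 ≤ g z - g x := by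
  have hmid := map_midpoint_le_of_strongConvexOn hg (hCS hx) (hCS hz)
  have hle := isMinOn_iff.1 hmin _ (hC.midpoint_mem hx hz)
  linarith

theorem isMinOn_of_isMinOn_inter_closedBall {c : E} {R : ℝ} (hg : ConvexOn ℝ S g) (hx : x ∈ S)
    (hmin : IsMinOn g (S ∩ Metric.closedBall c R) x) (hlt : ‖x - c‖ < R) : IsMinOn g S x := by
  refine IsMinOn.of_isLocalMinOn_of_convexOn hx ?_ hg
  have hball : Metric.closedBall c R ∈ nhdsWithin x S :=
    mem_nhdsWithin_of_mem_nhds (Metric.closedBall_mem_nhds_of_mem (mem_ball_iff_norm.2 hlt))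
  filter_upwards [self_mem_nhdsWithin, hball] with z hz hzball using hmin ⟨hz, hzball⟩

end StrongConvexity

section Subgradient

variable {d : ℕ} {S : Set (EuclideanSpace ℝ (Fin d))} {g : EuclideanSpace ℝ (Fin d) → ℝ}
  {c : EuclideanSpace ℝ (Fin d)} {m R : ℝ}

/-- `g` has a subgradient at every point of `S`. Such a `g` is lower semicontinuous on `S`, which is
all the regularity needed for minimizers to exist. -/
def SubdifferentiableOn (S : Set (EuclideanSpace ℝ (Fin d))) (g : EuclideanSpace ℝ (Fin d) → ℝ) :
    Prop :=
  ∀ x ∈ S, ∃ v, IsSubgradientOn S g x v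

theorem SubdifferentiableOn.lowerSemicontinuousOn (hg : SubdifferentiableOn S g) :
    LowerSemicontinuousOn g S := by
  intro x hx y hy
  obtain ⟨v, hv⟩ := hg x hx
  have hcont : ContinuousAt (fun z => g x + inner ℝ v (z - x)) x := by fun_prop
  have hlt : y < g x + inner ℝ v (x - x) := by simpa using hy
  filter_upwards [self_mem_nhdsWithin,
    mem_nhdsWithin_of_mem_nhds (hcont.eventually (lt_mem_nhds hlt))] with z hz hyz
  exact hyz.trans_le (hv z hz)

theorem SubdifferentiableOn.exists_isMinOn_inter_closedBall (hg : SubdifferentiableOn S g)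
    (hconv : StrongConvexOn S m g) (hm : 0 ≤ m) (hS : IsClosed S) (hc : c ∈ S) (hR : 0 ≤ R) :
    ∃ a ∈ S ∩ Metric.closedBall c R, m / 4 * ‖a - c‖ ^ 2 ≤ g c - g a ∧
      (‖a - c‖ < R → IsMinOn g S a) := by
  have hcball : c ∈ S ∩ Metric.closedBall c R := ⟨hc, Metric.mem_closedBall_self hR⟩
  obtain ⟨a, ha, hmin⟩ := (hg.lowerSemicontinuousOn.mono Set.inter_subset_left).exists_isMinOn
    ⟨c, hcball⟩ ((isCompact_closedBall c R).inter_left hS)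
  exact ⟨a, ha, mul_norm_sub_sq_le_of_isMinOn hconv Set.inter_subset_left
    (hconv.1.inter (convex_closedBall c R)) ha hmin hcball,
    isMinOn_of_isMinOn_inter_closedBall (convexOn_of_strongConvexOn hm hconv) ha.1 hmin⟩

theorem SubdifferentiableOn.exists_isMinOn (hg : SubdifferentiableOn S g)
    (hconv : StrongConvexOn S m g) (hm : 0 < m) (hS : IsClosed S) (hne : S.Nonempty) :
    ∃ a ∈ S, IsMinOn g S a := by
  obtain ⟨c, hc⟩ := hne
  obtain ⟨v, hv⟩ := hg c hc
  obtain ⟨a, ha, hgrowth, hmin⟩ :=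
    hg.exists_isMinOn_inter_closedBall (R := 4 * ‖v‖ / m + 1) hconv hm.le hS hc (by positivity)
  refine ⟨a, ha.1, hmin ?_⟩
  have hdecrease : g c - g a ≤ ‖v‖ * ‖a - c‖ := by
    linarith [hv a ha.1, neg_le_of_abs_le (abs_real_inner_le_norm v (a - c))]
  have hbound : ‖a - c‖ ≤ 4 * ‖v‖ / m := by
    rw [le_div_iff₀' hm]
    by_contra! hlt
    have hpos : 0 < ‖a - c‖ :=
      pos_of_mul_pos_right ((by positivity : 0 ≤ 4 * ‖v‖).trans_lt hlt) hm.le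
    nlinarith
  linarith

end Subgradient

section DualityGap

variable {d n : ℕ} {X : Set (EuclideanSpace ℝ (Fin d))} {Y : Set (EuclideanSpace ℝ (Fin n))}
  {f : EuclideanSpace ℝ (Fin d) → EuclideanSpace ℝ (Fin n) → ℝ} {m : ℝ}
  {x a : EuclideanSpace ℝ (Fin d)} {y b : EuclideanSpace ℝ (Fin n)}

theorem apply_argminOn_eq {E : Type*} [Nonempty E] {g : E → ℝ} {S : Set E} {a : E} (ha : a ∈ S)
    (hmin : IsMinOn g S a) : g (argminOn g S) = g a := by
  obtain ⟨hmem, hargmin⟩ : argminOn g S ∈ S ∧ IsMinOn g S (argminOn g S) :=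
    Classical.epsilon_spec (p := fun a => a ∈ S ∧ IsMinOn g S a) ⟨a, ha, hmin⟩
  exact le_antisymm (hargmin ha) (hmin hmem)

theorem apply_argmaxOn_eq {E : Type*} [Nonempty E] {g : E → ℝ} {S : Set E} {b : E} (hb : b ∈ S)
    (hmax : IsMaxOn g S b) : g (argmaxOn g S) = g b := by
  obtain ⟨hmem, hargmax⟩ : argmaxOn g S ∈ S ∧ IsMaxOn g S (argmaxOn g S) :=
    Classical.epsilon_spec (p := fun a => a ∈ S ∧ IsMaxOn g S a) ⟨b, hb, hmax⟩
  exact le_antisymm (hmax hmem) (hargmax hb)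

theorem dualityGap_eq_sub (ha : a ∈ X) (hmin : IsMinOn (fun x' => f x' y) X a) (hb : b ∈ Y)
    (hmax : IsMaxOn (fun y' => f x y') Y b) : dualityGap X Y f x y = f x b - f a y :=
  congrArg₂ (· - ·) (apply_argmaxOn_eq hb hmax) (apply_argminOn_eq ha hmin)

/-- The saddle functions of the theorem: `f` is `m`-strongly convex in `x ∈ X` and `m`-strongly
concave in `y ∈ Y`, and subdifferentiable in each variable. Concavity is phrased as convexity of
`-f`, which makes the two players symmetric, see `IsStronglyConvexConcave.swap`. -/
structure IsStronglyConvexConcave (X : Set (EuclideanSpace ℝ (Fin d)))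
    (Y : Set (EuclideanSpace ℝ (Fin n)))
    (f : EuclideanSpace ℝ (Fin d) → EuclideanSpace ℝ (Fin n) → ℝ) (m : ℝ) : Prop where
  pos : 0 < m
  isClosed_left : IsClosed X
  isClosed_right : IsClosed Y
  strongConvexOn_left : ∀ y ∈ Y, StrongConvexOn X m (fun x => f x y)
  strongConvexOn_right : ∀ x ∈ X, StrongConvexOn Y m (fun y => -f x y)
  subdifferentiableOn_left : ∀ y ∈ Y, SubdifferentiableOn X (fun x => f x y)
  subdifferentiableOn_right : ∀ x ∈ X, SubdifferentiableOn Y (fun y => -f x y)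

namespace IsStronglyConvexConcave

theorem swap (h : IsStronglyConvexConcave X Y f m) :
    IsStronglyConvexConcave Y X (fun y x => -f x y) m where
  pos := h.pos
  isClosed_left := h.isClosed_right
  isClosed_right := h.isClosed_left
  strongConvexOn_left := h.strongConvexOn_right
  strongConvexOn_right y hy := by simpa only [neg_neg] using h.strongConvexOn_left y hy
  subdifferentiableOn_left := h.subdifferentiableOn_right
  subdifferentiableOn_right y hy := by simpa only [neg_neg] using h.subdifferentiableOn_left y hy

theorem exists_isMinOn (h : IsStronglyConvexConcave X Y f m) (hx : x ∈ X) (hy : y ∈ Y) :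
    ∃ a ∈ X, IsMinOn (fun x' => f x' y) X a :=
  (h.subdifferentiableOn_left y hy).exists_isMinOn (h.strongConvexOn_left y hy) h.pos
    h.isClosed_left ⟨x, hx⟩

theorem exists_isMaxOn (h : IsStronglyConvexConcave X Y f m) (hx : x ∈ X) (hy : y ∈ Y) :
    ∃ b ∈ Y, IsMaxOn (fun y' => f x y') Y b := by
  obtain ⟨b, hb, hmin⟩ := h.swap.exists_isMinOn hy hx
  exact ⟨b, hb, by simpa only [neg_neg] using hmin.neg⟩

theorem sub_le_dualityGap (h : IsStronglyConvexConcave X Y f m) (hx : x ∈ X) (hy : y ∈ Y)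
    (ha : a ∈ X) (hb : b ∈ Y) : f x b - f a y ≤ dualityGap X Y f x y := by
  obtain ⟨a', ha', hmin⟩ := h.exists_isMinOn hx hy
  obtain ⟨b', hb', hmax⟩ := h.exists_isMaxOn hx hy
  rw [dualityGap_eq_sub ha' hmin hb' hmax]
  exact sub_le_sub (hmax hb) (hmin ha)

-- Strong convexity forces the optimizers over the balls into their interiors, where they are global
-- optimizers; hence the restricted gap is the full one.
theorem dualityGap_le_of_forall_sub_le (h : IsStronglyConvexConcave X Y f m)
    {c₁ : EuclideanSpace ℝ (Fin d)} {c₂ : EuclideanSpace ℝ (Fin n)} (hc₁ : c₁ ∈ X) (hc₂ : c₂ ∈ Y)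
    {R : ℝ} (hR : 0 < R) (hgap : dualityGap X Y f c₁ c₂ ≤ m * R ^ 2 / 8) (hx : x ∈ X) (hy : y ∈ Y)
    (hregret : ∀ a ∈ X ∩ Metric.closedBall c₁ R, ∀ b ∈ Y ∩ Metric.closedBall c₂ R,
      f x b - f a y ≤ 3 * m / 160 * (‖a - c₁‖ ^ 2 + ‖b - c₂‖ ^ 2) + 37 / 800 * (m * R ^ 2)) :
    dualityGap X Y f x y ≤ m * R ^ 2 / 16 := by
  obtain ⟨a, ha, hgrowth_a, hmin⟩ :=
    (h.subdifferentiableOn_left y hy).exists_isMinOn_inter_closedBall (h.strongConvexOn_left y hy)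
      h.pos.le h.isClosed_left hc₁ hR.le
  obtain ⟨b, hb, hgrowth_b, hmax⟩ :=
    (h.subdifferentiableOn_right x hx).exists_isMinOn_inter_closedBall
      (h.strongConvexOn_right x hx) h.pos.le h.isClosed_right hc₂ hR.le
  have hcenter : f c₁ y - f x c₂ ≤ m * R ^ 2 / 8 :=
    (h.sub_le_dualityGap hc₁ hc₂ hx hy).trans hgap
  have hrestricted := hregret a ha b hb
  have hmR : 0 < m * R ^ 2 := mul_pos h.pos (by positivity)
  have hdist : ‖a - c₁‖ ^ 2 + ‖b - c₂‖ ^ 2 < R ^ 2 := by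
    refine lt_of_mul_lt_mul_left ?_ h.pos.le
    linarith
  have hmin' : IsMinOn (fun x' => f x' y) X a :=
    hmin (lt_of_pow_lt_pow_left₀ 2 hR.le (by linarith [sq_nonneg ‖b - c₂‖]))
  have hmax' : IsMaxOn (fun y' => f x y') Y b := by
    simpa only [neg_neg] using
      (hmax (lt_of_pow_lt_pow_left₀ 2 hR.le (by linarith [sq_nonneg ‖a - c₁‖]))).neg
  rw [dualityGap_eq_sub ha.1 hmin' hb.1 hmax']
  linarith

end IsStronglyConvexConcave

theorem mul_sub_average_le {xs g₁ : ℕ → EuclideanSpace ℝ (Fin d)}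
    {ys g₂ : ℕ → EuclideanSpace ℝ (Fin n)} {T : ℕ} (hT : 0 < T)
    (hfx : ConvexOn ℝ X (fun x => f x b)) (hfy : ConvexOn ℝ Y (fun y => -f a y))
    (hxs : ∀ t, xs t ∈ X) (hys : ∀ t, ys t ∈ Y) (ha : a ∈ X) (hb : b ∈ Y)
    (hg₁ : ∀ t, IsSubgradientOn X (fun x => f x (ys t)) (xs t) (g₁ t))
    (hg₂ : ∀ t, IsSubgradientOn Y (fun y => -f (xs t) y) (ys t) (g₂ t)) :
    T * (f ((1 / (T : ℝ)) • ∑ t ∈ Finset.range T, xs t) b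
        - f a ((1 / (T : ℝ)) • ∑ t ∈ Finset.range T, ys t)) ≤
      ∑ t ∈ Finset.range T, inner ℝ (g₁ t) (xs t - a)
        + ∑ t ∈ Finset.range T, inner ℝ (g₂ t) (ys t - b) := by
  have hjensen₁ := mul_map_average_le hfx hT hxs
  have hjensen₂ := mul_map_average_le hfy hT hys
  have hlinear : ∑ t ∈ Finset.range T, (f (xs t) b - f a (ys t)) ≤
      ∑ t ∈ Finset.range T, (inner ℝ (g₁ t) (xs t - a) + inner ℝ (g₂ t) (ys t - b)) := by
    refine Finset.sum_le_sum fun t _ => ?_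
    rw [← neg_sub a, ← neg_sub b, inner_neg_right, inner_neg_right]
    linarith [hg₁ t a ha, hg₂ t b hb]
  rw [Finset.sum_sub_distrib, Finset.sum_add_distrib] at hlinear
  rw [Finset.sum_neg_distrib] at hjensen₂
  linarith

end DualityGap

section LogEValue

variable {Ξ : Type*} [MeasurableSpace Ξ] {ν : Measure Ξ} {A A' Z : Ξ → ℝ}

/-- `A` is the logarithm of an e-value: `E[exp A] ≤ 1`. The expectation is a Lebesgue integral in
`[0, ∞]`, so no integrability is presupposed. -/
def IsLogEValue (ν : Measure Ξ) (A : Ξ → ℝ) : Prop :=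
  Measurable A ∧ ∫⁻ s, ENNReal.ofReal (Real.exp (A s)) ∂ν ≤ 1

namespace IsLogEValue

theorem mono (hA : IsLogEValue ν A) (hA' : Measurable A') (hle : ∀ s, A' s ≤ A s) :
    IsLogEValue ν A' :=
  ⟨hA', (lintegral_mono fun s => ENNReal.ofReal_le_ofReal (Real.exp_le_exp.2 (hle s))).trans hA.2⟩

theorem zero [IsProbabilityMeasure ν] : IsLogEValue ν fun _ => 0 :=
  ⟨measurable_const, by simp⟩

theorem convex_combination (hA : IsLogEValue ν A) (hA' : IsLogEValue ν A') {r : ℝ} (hr₀ : 0 ≤ r)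
    (hr₁ : r ≤ 1) : IsLogEValue ν fun s => r * A s + (1 - r) * A' s := by
  have hr : 0 ≤ 1 - r := sub_nonneg.2 hr₁
  have hconv : ∀ s, Real.exp (r * A s + (1 - r) * A' s) ≤
      r * Real.exp (A s) + (1 - r) * Real.exp (A' s) := fun s =>
    convexOn_exp.2 (Set.mem_univ _) (Set.mem_univ _) hr₀ hr (add_sub_cancel r 1)
  have hmeas := hA.1
  have hmeas' := hA'.1
  refine ⟨by fun_prop, ?_⟩
  calc ∫⁻ s, ENNReal.ofReal (Real.exp (r * A s + (1 - r) * A' s)) ∂ν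
      ≤ ∫⁻ s, (ENNReal.ofReal r * ENNReal.ofReal (Real.exp (A s))
          + ENNReal.ofReal (1 - r) * ENNReal.ofReal (Real.exp (A' s))) ∂ν := by
        refine lintegral_mono fun s => ?_
        rw [← ENNReal.ofReal_mul hr₀, ← ENNReal.ofReal_mul hr,
          ← ENNReal.ofReal_add (by positivity) (by positivity)]
        exact ENNReal.ofReal_le_ofReal (hconv s)
    _ = ENNReal.ofReal r * ∫⁻ s, ENNReal.ofReal (Real.exp (A s)) ∂ν
          + ENNReal.ofReal (1 - r) * ∫⁻ s, ENNReal.ofReal (Real.exp (A' s)) ∂ν := by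
        rw [lintegral_add_left (by fun_prop), lintegral_const_mul _ (by fun_prop),
          lintegral_const_mul _ (by fun_prop)]
    _ ≤ ENNReal.ofReal r * 1 + ENNReal.ofReal (1 - r) * 1 := by
        gcongr
        exacts [hA.2, hA'.2]
    _ = 1 := by
        rw [mul_one, mul_one, ← ENNReal.ofReal_add hr₀ hr, add_sub_cancel, ENNReal.ofReal_one]

theorem const_mul [IsProbabilityMeasure ν] (hA : IsLogEValue ν A) {r : ℝ} (hr₀ : 0 ≤ r)
    (hr₁ : r ≤ 1) : IsLogEValue ν fun s => r * A s := by
  simpa only [mul_zero, add_zero] using hA.convex_combination zero hr₀ hr₁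

theorem integrable_exp (hA : IsLogEValue ν A) : Integrable (fun s => Real.exp (A s)) ν :=
  (lintegral_ofReal_ne_top_iff_integrable hA.1.exp.aestronglyMeasurable
    (Filter.Eventually.of_forall fun _ => (Real.exp_pos _).le)).1
    (ne_top_of_le_ne_top ENNReal.one_ne_top hA.2)

theorem integral_exp_le (hA : IsLogEValue ν A) : ∫ s, Real.exp (A s) ∂ν ≤ 1 := by
  rw [integral_eq_lintegral_of_nonneg_ae (Filter.Eventually.of_forall fun _ => (Real.exp_pos _).le)
    hA.1.exp.aestronglyMeasurable]
  exact ENNReal.toReal_le_of_le_ofReal zero_le_one (by simpa only [ENNReal.ofReal_one] using hA.2)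

theorem of_exp_le_add (hA : IsLogEValue ν A) (hA' : Measurable A') (hZ : Integrable Z ν)
    (hZ₀ : ∫ s, Z s ∂ν = 0) (hle : ∀ s, Real.exp (A' s) ≤ Z s + Real.exp (A s)) :
    IsLogEValue ν A' := by
  refine ⟨hA', ?_⟩
  calc ∫⁻ s, ENNReal.ofReal (Real.exp (A' s)) ∂ν
      ≤ ∫⁻ s, ENNReal.ofReal (Z s + Real.exp (A s)) ∂ν :=
        lintegral_mono fun s => ENNReal.ofReal_le_ofReal (hle s)
    _ = ENNReal.ofReal (∫ s, (Z s + Real.exp (A s)) ∂ν) :=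
        (ofReal_integral_eq_lintegral_ofReal (hZ.add hA.integrable_exp)
          (Filter.Eventually.of_forall fun s => (Real.exp_pos _).le.trans (hle s))).symm
    _ ≤ ENNReal.ofReal 1 := by
        rw [integral_add hZ hA.integrable_exp, hZ₀, zero_add]
        exact ENNReal.ofReal_le_ofReal hA.integral_exp_le
    _ = 1 := ENNReal.ofReal_one

theorem measureReal_lt_le [IsFiniteMeasure ν] (hA : IsLogEValue ν A) (L : ℝ) :
    ν.real {s | L < A s} ≤ Real.exp (-L) := by
  have hmarkov := mul_meas_ge_le_integral_of_nonneg
    (Filter.Eventually.of_forall fun s => (Real.exp_pos (A s)).le) hA.integrable_exp (Real.exp L)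
  have hsubset : ν.real {s | L < A s} ≤ ν.real {s | Real.exp L ≤ Real.exp (A s)} :=
    measureReal_mono fun s hs => Real.exp_le_exp.2 (le_of_lt hs)
  rw [Real.exp_neg, inv_eq_one_div, le_div_iff₀' (Real.exp_pos L)]
  exact (mul_le_mul_of_nonneg_left hsubset (Real.exp_pos L).le).trans
    (hmarkov.trans hA.integral_exp_le)

end IsLogEValue

end LogEValue

section PsiTwoNorm

theorem exp_le_add_exp_sq (x : ℝ) : Real.exp x ≤ x + Real.exp (x ^ 2) := by
  have hsq := Real.add_one_le_exp (x ^ 2)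
  rcases le_or_gt |x| 1 with hx | hx
  · linarith [(abs_le.1 (Real.abs_exp_sub_one_sub_id_le hx)).2]
  · rcases lt_abs.1 hx with hx | hx
    · linarith [Real.exp_le_exp.2 (show x ≤ x ^ 2 by nlinarith)]
    · nlinarith [Real.exp_le_one_iff.2 (show x ≤ 0 by linarith)]

theorem le_mul_exp_half_sq_div_sub_one {σ : ℝ} (hσ : 0 < σ) (a : ℝ) :
    a ≤ σ * Real.exp (1 / 2 * (a ^ 2 / σ ^ 2 - 1)) := by
  have hexp := Real.add_one_le_exp (1 / 2 * (a ^ 2 / σ ^ 2 - 1))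
  have hamgm : a / σ ≤ 1 / 2 * (a ^ 2 / σ ^ 2 - 1) + 1 := by
    rw [← div_pow]
    nlinarith [sq_nonneg (a / σ - 1)]
  rw [← div_le_iff₀' hσ]
  exact hamgm.trans hexp

variable {Ξ : Type*} [MeasurableSpace Ξ] {ν : Measure Ξ} {V W : Ξ → ℝ} {σ τ : ℝ}

/-- The random variable `V` has `ψ₂`-norm (sub-Gaussian Orlicz norm) at most `σ`, in the
normalization `E[exp (V² / σ²)] ≤ e`. -/
structure HasPsiTwoNormLE (ν : Measure Ξ) (V : Ξ → ℝ) (σ : ℝ) : Prop where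
  pos : 0 < σ
  measurable : Measurable V
  isLogEValue : IsLogEValue ν fun s => V s ^ 2 / σ ^ 2 - 1

theorem SubGaussianNorm.hasPsiTwoNormLE {d : ℕ} {V : Ξ → EuclideanSpace ℝ (Fin d)}
    (hV : SubGaussianNorm ν V σ) (hVm : Measurable V) (hσ : 0 < σ) :
    HasPsiTwoNormLE ν (fun s => ‖V s‖) σ where
  pos := hσ
  measurable := hVm.norm
  isLogEValue := by
    refine ⟨by fun_prop, ?_⟩
    calc ∫⁻ s, ENNReal.ofReal (Real.exp (‖V s‖ ^ 2 / σ ^ 2 - 1)) ∂ν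
        = (∫⁻ s, ENNReal.ofReal (Real.exp (‖V s‖ ^ 2 / σ ^ 2)) ∂ν)
            / ENNReal.ofReal (Real.exp 1) := by
          simp only [Real.exp_sub, ENNReal.ofReal_div_of_pos (Real.exp_pos 1),
            ENNReal.div_eq_inv_mul]
          exact lintegral_const_mul _ (by fun_prop)
      _ ≤ 1 := ENNReal.div_le_of_le_mul (by rw [one_mul]; exact hV)

namespace HasPsiTwoNormLE

theorem mono (hV : HasPsiTwoNormLE ν V σ) (hW : Measurable W) (hle : ∀ s, |W s| ≤ |V s|) :
    HasPsiTwoNormLE ν W σ where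
  pos := hV.pos
  measurable := hW
  isLogEValue := hV.isLogEValue.mono (by fun_prop) fun s => by
    gcongr ?_ / _ - _
    exact sq_le_sq.2 (hle s)

theorem const [IsProbabilityMeasure ν] (hσ : 0 < σ) : HasPsiTwoNormLE ν (fun _ => σ) σ where
  pos := hσ
  measurable := measurable_const
  isLogEValue := by
    rw [div_self (by positivity), sub_self]
    exact IsLogEValue.zero

theorem const_mul (hV : HasPsiTwoNormLE ν V σ) {c : ℝ} (hc : 0 < c) :
    HasPsiTwoNormLE ν (fun s => c * V s) (c * σ) where
  pos := mul_pos hc hV.pos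
  measurable := hV.measurable.const_mul c
  isLogEValue := by
    simp only [mul_pow, mul_div_mul_left _ _ (pow_ne_zero 2 hc.ne')]
    exact hV.isLogEValue

-- By convexity of the square, `((V + W) / (σ + τ))²` is at most the average of `(V / σ)²` and
-- `(W / τ)²` with weights `σ / (σ + τ)` and `τ / (σ + τ)`.
theorem add (hV : HasPsiTwoNormLE ν V σ) (hW : HasPsiTwoNormLE ν W τ) :
    HasPsiTwoNormLE ν (fun s => V s + W s) (σ + τ) where
  pos := add_pos hV.pos hW.pos
  measurable := hV.measurable.add hW.measurable
  isLogEValue := by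
    have hσ := hV.pos
    have hτ := hW.pos
    have hVm := hV.measurable
    have hWm := hW.measurable
    have hsq : ∀ a b : ℝ, (a + b) ^ 2 / (σ + τ) ^ 2 ≤
        σ / (σ + τ) * (a ^ 2 / σ ^ 2) + (1 - σ / (σ + τ)) * (b ^ 2 / τ ^ 2) := fun a b => by
      have hdiff : σ / (σ + τ) * (a ^ 2 / σ ^ 2) + (1 - σ / (σ + τ)) * (b ^ 2 / τ ^ 2)
          - (a + b) ^ 2 / (σ + τ) ^ 2 = (τ * a - σ * b) ^ 2 / (σ * τ * (σ + τ) ^ 2) := by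
        field_simp
        ring
      have : 0 ≤ (τ * a - σ * b) ^ 2 / (σ * τ * (σ + τ) ^ 2) := by positivity
      linarith
    refine (hV.isLogEValue.convex_combination hW.isLogEValue (r := σ / (σ + τ)) (by positivity)
      ((div_le_one (by positivity)).2 (by linarith))).mono (by fun_prop) fun s => ?_
    linarith [hsq (V s) (W s)]

variable [IsProbabilityMeasure ν]

theorem integrable (hV : HasPsiTwoNormLE ν V σ) : Integrable V ν := by
  have hexp := hV.isLogEValue.const_mul (r := 1 / 2) (by norm_num) (by norm_num)
  refine (hexp.integrable_exp.const_mul σ).mono' hV.measurable.aestronglyMeasurable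
    (Filter.Eventually.of_forall fun s => ?_)
  rw [Real.norm_eq_abs, ← sq_abs (V s)]
  exact le_mul_exp_half_sq_div_sub_one hV.pos _

theorem integral_le (hV : HasPsiTwoNormLE ν V σ) : ∫ s, V s ∂ν ≤ σ := by
  have hexp := hV.isLogEValue.const_mul (r := 1 / 2) (by norm_num) (by norm_num)
  calc ∫ s, V s ∂ν ≤ ∫ s, σ * Real.exp (1 / 2 * (V s ^ 2 / σ ^ 2 - 1)) ∂ν :=
        integral_mono hV.integrable (hexp.integrable_exp.const_mul σ)
          fun s => le_mul_exp_half_sq_div_sub_one hV.pos _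
    _ ≤ σ := by
        rw [integral_const_mul]
        exact mul_le_of_le_one_right hV.pos.le hexp.integral_exp_le

theorem isLogEValue_centered (hV : HasPsiTwoNormLE ν V σ) (hV₀ : ∫ s, V s ∂ν = 0) (θ : ℝ) :
    IsLogEValue ν fun s => θ * V s - θ ^ 2 * σ ^ 2 := by
  have hσ := hV.pos
  have hmeas : Measurable fun s => θ * V s - θ ^ 2 * σ ^ 2 :=
    (hV.measurable.const_mul θ).sub_const _
  rcases le_or_gt (θ ^ 2 * σ ^ 2) 1 with hθ | hθ
  · refine (hV.isLogEValue.const_mul (by positivity) hθ).of_exp_le_add hmeas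
      (Z := fun s => Real.exp (-(θ ^ 2 * σ ^ 2)) * (θ * V s))
      ((hV.integrable.const_mul θ).const_mul _) ?_ fun s => ?_
    · rw [integral_const_mul, integral_const_mul, hV₀, mul_zero, mul_zero]
    · have hscale : θ ^ 2 * σ ^ 2 * (V s ^ 2 / σ ^ 2 - 1) = -(θ ^ 2 * σ ^ 2) + (θ * V s) ^ 2 := by
        field_simp
        ring
      rw [hscale, sub_eq_neg_add, Real.exp_add, Real.exp_add, ← mul_add]
      exact mul_le_mul_of_nonneg_left (exp_le_add_exp_sq _) (Real.exp_pos _).le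
  · refine (hV.isLogEValue.const_mul (r := 1 / 2) (by norm_num) (by norm_num)).mono hmeas
      fun s => ?_
    have hsq : (θ * σ - V s / σ) ^ 2 = θ ^ 2 * σ ^ 2 - 2 * (θ * V s) + V s ^ 2 / σ ^ 2 := by
      field_simp
      ring
    linarith [sq_nonneg (θ * σ - V s / σ)]

theorem isLogEValue_add_centered {A : Ξ → ℝ} (hA : IsLogEValue ν A) (hV : HasPsiTwoNormLE ν V σ)
    (hV₀ : ∫ s, V s ∂ν = 0) {r : ℝ} (hr₀ : 0 ≤ r) (hr₁ : r ≤ 2 / 3) (κ : ℝ) :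
    IsLogEValue ν fun s => r * A s + (κ * V s - 3 * κ ^ 2 * σ ^ 2) := by
  have hA_meas := hA.1
  have hV_meas := hV.measurable
  have hr : 0 < 1 - r := by linarith
  refine (hA.convex_combination (hV.isLogEValue_centered hV₀ (κ / (1 - r))) hr₀
    (by linarith)).mono (by fun_prop) fun s => ?_
  have hκ : (1 - r) * (κ / (1 - r) * V s - (κ / (1 - r)) ^ 2 * σ ^ 2) =
      κ * V s - (κ * σ) ^ 2 / (1 - r) := by
    field_simp
  have hle : (κ * σ) ^ 2 / (1 - r) ≤ 3 * κ ^ 2 * σ ^ 2 := by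
    rw [div_le_iff₀ hr]
    nlinarith [sq_nonneg (κ * σ)]
  linarith

end HasPsiTwoNormLE

end PsiTwoNorm

section Oracle

variable {α Ξ : Type*} [MeasurableSpace α] [MeasurableSpace Ξ] {ν : Measure Ξ} {d n : ℕ}
  {S : Set α} {G : α → Ξ → EuclideanSpace ℝ (Fin d)} {H : α → Ξ → EuclideanSpace ℝ (Fin n)}
  {B B' η η' r : ℝ} {z : α} {v : EuclideanSpace ℝ (Fin d)} {v' : EuclideanSpace ℝ (Fin n)}

/-- `G z` is a stochastic oracle for a direction at the state `z`, queried with a sample of law `ν`;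
its norm is sub-Gaussian with constant `B` for every `z ∈ S`. -/
structure IsSubGaussianOracle (ν : Measure Ξ) (S : Set α) (G : α → Ξ → EuclideanSpace ℝ (Fin d))
    (B : ℝ) : Prop where
  pos : 0 < B
  measurable : Measurable (Function.uncurry G)
  subGaussianNorm : ∀ z ∈ S, SubGaussianNorm ν (G z) B

/-- The error of the oracle `G` at the state `z` as an estimate of its mean. -/
noncomputable def oracleNoise (ν : Measure Ξ) (G : α → Ξ → EuclideanSpace ℝ (Fin d)) (z : α)
    (s : Ξ) : EuclideanSpace ℝ (Fin d) :=
  (∫ s', G z s' ∂ν) - G z s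

/-- The contribution to the regret of one descent step of size `η` along `G z s`, where `v` is the
difference of the iterate and the ghost iterate; see `sum_inner_projDescent_le_of_estimate`. -/
noncomputable def stepError (ν : Measure Ξ) (G : α → Ξ → EuclideanSpace ℝ (Fin d)) (η B : ℝ) (z : α)
    (v : EuclideanSpace ℝ (Fin d)) (s : Ξ) : ℝ :=
  η * (‖G z s‖ ^ 2 + B ^ 2 / 2) + inner ℝ (oracleNoise ν G z s) v

namespace IsSubGaussianOracle

theorem hasPsiTwoNormLE_norm (hG : IsSubGaussianOracle ν S G B) (hz : z ∈ S) :
    HasPsiTwoNormLE ν (fun s => ‖G z s‖) B :=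
  (hG.subGaussianNorm z hz).hasPsiTwoNormLE hG.measurable.of_uncurry_left hG.pos

variable [IsProbabilityMeasure ν]

theorem measurable_oracleNoise (hG : IsSubGaussianOracle ν S G B) :
    Measurable (Function.uncurry (oracleNoise ν G)) := by
  have hmean := hG.measurable.stronglyMeasurable.integral_prod_right (ν := ν)
  exact (hmean.measurable.comp measurable_fst).sub hG.measurable

theorem measurable_stepError (hG : IsSubGaussianOracle ν S G B) :
    Measurable fun q : (α × EuclideanSpace ℝ (Fin d)) × Ξ => stepError ν G η B q.1.1 q.1.2 q.2 := by
  have hquery : Measurable fun q : (α × EuclideanSpace ℝ (Fin d)) × Ξ => (q.1.1, q.2) := by fun_prop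
  have hvalue : Measurable fun q : (α × EuclideanSpace ℝ (Fin d)) × Ξ => G q.1.1 q.2 :=
    hG.measurable.comp hquery
  have hnoise : Measurable fun q : (α × EuclideanSpace ℝ (Fin d)) × Ξ =>
      oracleNoise ν G q.1.1 q.2 := hG.measurable_oracleNoise.comp hquery
  exact ((hvalue.norm.pow_const 2).add_const _ |>.const_mul η).add
    (hnoise.inner (measurable_snd.comp measurable_fst))

theorem integrable (hG : IsSubGaussianOracle ν S G B) (hz : z ∈ S) : Integrable (G z) ν :=
  (integrable_norm_iff hG.measurable.of_uncurry_left.aestronglyMeasurable).1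
    (hG.hasPsiTwoNormLE_norm hz).integrable

theorem norm_integral_le (hG : IsSubGaussianOracle ν S G B) (hz : z ∈ S) :
    ‖∫ s, G z s ∂ν‖ ≤ B :=
  (norm_integral_le_integral_norm _).trans (hG.hasPsiTwoNormLE_norm hz).integral_le

theorem integral_inner_oracleNoise (hG : IsSubGaussianOracle ν S G B) (hz : z ∈ S)
    (v : EuclideanSpace ℝ (Fin d)) : ∫ s, inner ℝ (oracleNoise ν G z s) v ∂ν = 0 := by
  have hint : Integrable (oracleNoise ν G z) ν := (integrable_const _).sub (hG.integrable hz)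
  have hzero : ∫ s, oracleNoise ν G z s ∂ν = 0 := by
    simp only [oracleNoise]
    rw [integral_sub (integrable_const _) (hG.integrable hz), integral_const, probReal_univ,
      one_smul, sub_self]
  simp_rw [real_inner_comm v]
  rw [integral_inner hint, hzero, inner_zero_right]

theorem hasPsiTwoNormLE_inner_oracleNoise (hG : IsSubGaussianOracle ν S G B) (hz : z ∈ S)
    (hr : 0 < r) (hv : ‖v‖ ≤ r) :
    HasPsiTwoNormLE ν (fun s => inner ℝ (oracleNoise ν G z s) v) (r * (B + B)) := by
  have hbound := ((HasPsiTwoNormLE.const hG.pos).add (hG.hasPsiTwoNormLE_norm hz)).const_mul hr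
  refine hbound.mono (hG.measurable_oracleNoise.of_uncurry_left.inner_const) fun s => ?_
  have hnoise : ‖oracleNoise ν G z s‖ ≤ B + ‖G z s‖ :=
    (norm_sub_le _ _).trans (add_le_add_left (hG.norm_integral_le hz) _)
  calc |inner ℝ (oracleNoise ν G z s) v| ≤ ‖oracleNoise ν G z s‖ * ‖v‖ :=
        abs_real_inner_le_norm _ _
    _ ≤ (B + ‖G z s‖) * r := mul_le_mul hnoise hv (norm_nonneg _) ((norm_nonneg _).trans hnoise)
    _ = r * (B + ‖G z s‖) := mul_comm _ _
    _ ≤ |r * (B + ‖G z s‖)| := le_abs_self _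

theorem isLogEValue_stepError_add (hG : IsSubGaussianOracle ν S G B)
    (hH : IsSubGaussianOracle ν S H B') (hz : z ∈ S) (hr : 0 < r) (hv : ‖v‖ ≤ r) (hv' : ‖v'‖ ≤ r)
    {a κ : ℝ} (hη : η * B ^ 2 = a) (hη' : η' * B' ^ 2 = a) (ha : 0 ≤ a) (hκ : 0 ≤ κ)
    (hκa : κ * a ≤ 1 / 3) :
    IsLogEValue ν fun s => κ * (stepError ν G η B z v s + stepError ν H η' B' z v' s
      - (3 * a + 12 * κ * (r * (B + B')) ^ 2)) := by
  have hsq : IsLogEValue ν fun s => 1 / 2 * (‖G z s‖ ^ 2 / B ^ 2 - 1)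
      + (1 - 1 / 2) * (‖H z s‖ ^ 2 / B' ^ 2 - 1) :=
    (hG.hasPsiTwoNormLE_norm hz).isLogEValue.convex_combination
      (hH.hasPsiTwoNormLE_norm hz).isLogEValue (by norm_num) (by norm_num)
  have hnoise := (hG.hasPsiTwoNormLE_inner_oracleNoise hz hr hv).add
    (hH.hasPsiTwoNormLE_inner_oracleNoise hz hr hv')
  have hcentered : ∫ s, (inner ℝ (oracleNoise ν G z s) v + inner ℝ (oracleNoise ν H z s) v') ∂ν
      = 0 := by
    rw [integral_add (hG.hasPsiTwoNormLE_inner_oracleNoise hz hr hv).integrable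
      (hH.hasPsiTwoNormLE_inner_oracleNoise hz hr hv').integrable,
      hG.integral_inner_oracleNoise hz, hH.integral_inner_oracleNoise hz, add_zero]
  convert hnoise.isLogEValue_add_centered hsq hcentered (r := 2 * (κ * a)) (by positivity)
    (by linarith) κ using 2 with s
  have hnorm : η * ‖G z s‖ ^ 2 = a * (‖G z s‖ ^ 2 / B ^ 2) := by
    rw [← hη]
    field_simp [hG.pos.ne']
  have hnorm' : η' * ‖H z s‖ ^ 2 = a * (‖H z s‖ ^ 2 / B' ^ 2) := by
    rw [← hη']
    field_simp [hH.pos.ne']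
  simp only [stepError, mul_add η, mul_add η', hnorm, hnorm']
  linear_combination κ / 2 * (hη + hη')

end IsSubGaussianOracle

end Oracle

section Independence

variable {Ω α Ξ : Type*} {𝓕 mΩ : MeasurableSpace Ω} [MeasurableSpace α] [MeasurableSpace Ξ]
  {P : Measure Ω} [IsProbabilityMeasure P] {ν : Measure Ξ} [IsProbabilityMeasure ν]

theorem lintegral_mul_le_of_indep {ξ : Ω → Ξ} (hξ : Measurable ξ) (hlaw : P.map ξ = ν)
    (h𝓕 : 𝓕 ≤ mΩ) (hind : Indep 𝓕 (MeasurableSpace.comap ξ inferInstance) P)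
    {Z : Ω → α} (hZ : Measurable[𝓕] Z) {Φ : Ω → ENNReal} (hΦ : Measurable[𝓕] Φ)
    {w : α → Ξ → ENNReal} (hw : Measurable (Function.uncurry w))
    (hle : ∀ ω, ∫⁻ s, w (Z ω) s ∂ν ≤ 1) :
    ∫⁻ ω, Φ ω * w (Z ω) (ξ ω) ∂P ≤ ∫⁻ ω, Φ ω ∂P := by
  have hpast : Measurable[𝓕] fun ω => (Φ ω, Z ω) := hΦ.prodMk hZ
  have hpast' : Measurable fun ω => (Φ ω, Z ω) := hpast.mono h𝓕 le_rfl
  have hindep : IndepFun (fun ω => (Φ ω, Z ω)) ξ P :=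
    (IndepFun_iff_Indep _ _ _).2 (indep_of_indep_of_le_left hind hpast.comap_le)
  have hjoint := (indepFun_iff_map_prod_eq_prod_map_map hpast'.aemeasurable hξ.aemeasurable).1
    hindep
  rw [hlaw] at hjoint
  have hF : Measurable fun q : (ENNReal × α) × Ξ => q.1.1 * w q.1.2 q.2 :=
    (measurable_fst.comp measurable_fst).mul
      (hw.comp ((measurable_snd.comp measurable_fst).prodMk measurable_snd))
  calc ∫⁻ ω, Φ ω * w (Z ω) (ξ ω) ∂P
      = ∫⁻ q, q.1.1 * w q.1.2 q.2 ∂(P.map fun ω => ((Φ ω, Z ω), ξ ω)) :=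
        (lintegral_map hF (hpast'.prodMk hξ)).symm
    _ = ∫⁻ a, ∫⁻ s, a.1 * w a.2 s ∂ν ∂(P.map fun ω => (Φ ω, Z ω)) := by
        rw [hjoint, lintegral_prod _ hF.aemeasurable]
    _ = ∫⁻ ω, ∫⁻ s, Φ ω * w (Z ω) s ∂ν ∂P :=
        lintegral_map (f := fun a : ENNReal × α => ∫⁻ s, a.1 * w a.2 s ∂ν)
          hF.lintegral_prod_right' hpast'
    _ ≤ ∫⁻ ω, Φ ω ∂P := by
        refine lintegral_mono fun ω => ?_
        simp only [lintegral_const_mul _ (hw.of_uncurry_left (x := Z ω))]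
        exact mul_le_of_le_one_right' (hle ω)

theorem isLogEValue_sum_of_indep {𝓕 : ℕ → MeasurableSpace Ω} (h𝓕 : ∀ t, 𝓕 t ≤ mΩ)
    (hmono : Monotone 𝓕) {ξ : ℕ → Ω → Ξ} (hξ : ∀ t, Measurable[𝓕 (t + 1)] (ξ t))
    (hlaw : ∀ t, P.map (ξ t) = ν)
    (hind : ∀ t, Indep (𝓕 t) (MeasurableSpace.comap (ξ t) inferInstance) P)
    {w : α → Ξ → ℝ} (hw : Measurable (Function.uncurry w))
    {Z : ℕ → Ω → α} (hZ : ∀ t, Measurable[𝓕 t] (Z t))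
    (hle : ∀ t ω, IsLogEValue ν (w (Z t ω))) (T : ℕ) :
    IsLogEValue P fun ω => ∑ t ∈ Finset.range T, w (Z t ω) (ξ t ω) := by
  have hterm : ∀ t, Measurable[𝓕 (t + 1)] fun ω => w (Z t ω) (ξ t ω) := fun t =>
    hw.comp (((hZ t).mono (hmono t.le_succ) le_rfl).prodMk (hξ t))
  have hsum : ∀ T, Measurable[𝓕 T] fun ω => ∑ t ∈ Finset.range T, w (Z t ω) (ξ t ω) := fun T =>
    Finset.measurable_sum _ fun t ht => (hterm t).mono (hmono (Finset.mem_range.1 ht)) le_rfl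
  refine ⟨(hsum T).mono (h𝓕 T) le_rfl, ?_⟩
  induction T with
  | zero => simp
  | succ T ih =>
    simp only [Finset.sum_range_succ, Real.exp_add, ENNReal.ofReal_mul (Real.exp_pos _).le]
    exact (lintegral_mul_le_of_indep (ν := ν) (w := fun z s => ENNReal.ofReal (Real.exp (w z s)))
      ((hξ T).mono (h𝓕 _) le_rfl) (hlaw T) (h𝓕 T) (hind T) (hZ T)
      (ENNReal.measurable_ofReal.comp (Real.measurable_exp.comp (hsum T)))
      (ENNReal.measurable_ofReal.comp (Real.measurable_exp.comp hw)) fun ω => (hle T ω).2).trans ih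

end Independence

section PastSamples

variable {Ω Ξ : Type*} [mΞ : MeasurableSpace Ξ]

/-- The information carried by the samples drawn before step `t` of epoch `k + 1`. -/
abbrev pastSamples (ξ : ℕ → ℕ → Ω → Ξ) (k t : ℕ) : MeasurableSpace Ω :=
  ⨆ i ∈ {i : ℕ × ℕ | i.1 < k ∨ i.1 = k ∧ i.2 < t}, mΞ.comap (ξ i.1 i.2)

theorem pastSamples_le [mΩ : MeasurableSpace Ω] {ξ : ℕ → ℕ → Ω → Ξ}
    (hξ : ∀ k t, Measurable (ξ k t)) (k t : ℕ) : pastSamples ξ k t ≤ mΩ :=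
  iSup₂_le fun i _ => (hξ i.1 i.2).comap_le

theorem pastSamples_mono (ξ : ℕ → ℕ → Ω → Ξ) (k : ℕ) : Monotone (pastSamples ξ k) :=
  fun _ _ h => biSup_mono fun _ hi => hi.imp_right fun hi => ⟨hi.1, hi.2.trans_le h⟩

theorem measurable_pastSamples (ξ : ℕ → ℕ → Ω → Ξ) {k t i j : ℕ}
    (h : i < k ∨ i = k ∧ j < t) : Measurable[pastSamples ξ k t] (ξ i j) :=
  measurable_iff_comap_le.2
    (le_iSup₂_of_le (f := fun (i : ℕ × ℕ) (_ : i ∈ {i : ℕ × ℕ | i.1 < k ∨ i.1 = k ∧ i.2 < t}) =>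
      mΞ.comap (ξ i.1 i.2)) (i, j) h le_rfl)

theorem indep_pastSamples [MeasurableSpace Ω] {P : Measure Ω} {ξ : ℕ → ℕ → Ω → Ξ}
    (hξ : ∀ k t, Measurable (ξ k t)) (hind : iIndepFun (fun i : ℕ × ℕ => ξ i.1 i.2) P) (k t : ℕ) :
    Indep (pastSamples ξ k t) (MeasurableSpace.comap (ξ k t) mΞ) P := by
  have hdisjoint := indep_iSup_of_disjoint (fun i : ℕ × ℕ => (hξ i.1 i.2).comap_le) hind.iIndep
    (S := {i : ℕ × ℕ | i.1 < k ∨ i.1 = k ∧ i.2 < t}) (T := {(k, t)})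
    (Set.disjoint_singleton_right.2 (by simp))
  rwa [iSup_singleton] at hdisjoint

end PastSamples

section Iterates

variable {Ξ : Type*} {d n : ℕ}
  {X : Set (EuclideanSpace ℝ (Fin d))} {Y : Set (EuclideanSpace ℝ (Fin n))}
  {Gx : EuclideanSpace ℝ (Fin d) → EuclideanSpace ℝ (Fin n) → Ξ → EuclideanSpace ℝ (Fin d)}
  {Gy : EuclideanSpace ℝ (Fin d) → EuclideanSpace ℝ (Fin n) → Ξ → EuclideanSpace ℝ (Fin n)}
  {B₁ B₂ : ℝ} {p : EpochParams}
  {z₀ : EuclideanSpace ℝ (Fin d) × EuclideanSpace ℝ (Fin n)}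

theorem innerIterate_eq_projDescent (z₀ : EuclideanSpace ℝ (Fin d) × EuclideanSpace ℝ (Fin n))
    (s : ℕ → Ξ) (t : ℕ) :
    innerIterate X Y Gx Gy p z₀.1 z₀.2 s t =
      (projDescent (X ∩ Metric.closedBall z₀.1 p.R) p.ηx
          (fun t => Function.uncurry Gx (innerIterate X Y Gx Gy p z₀.1 z₀.2 s t) (s t)) z₀.1 t,
        projDescent (Y ∩ Metric.closedBall z₀.2 p.R) p.ηy
          (fun t => Function.uncurry (-Gy) (innerIterate X Y Gx Gy p z₀.1 z₀.2 s t) (s t))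
          z₀.2 t) := by
  induction t with
  | zero => rfl
  | succ t ih =>
    simp only [Prod.ext_iff] at ih
    simp only [innerIterate, projDescent, ← ih.1, ← ih.2]
    simp only [Function.uncurry_def, Pi.neg_apply, smul_neg, sub_neg_eq_add]

variable [MeasurableSpace Ξ] {ν : Measure Ξ}

/-- The data on which Epoch-GDA runs: closed convex constraint sets and, for either player, a
sub-Gaussian oracle for a descent direction (the second player, who ascends, descends along
`-Gy`). -/
structure IsGDAOracle (ν : Measure Ξ) (X : Set (EuclideanSpace ℝ (Fin d)))
    (Y : Set (EuclideanSpace ℝ (Fin n)))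
    (Gx : EuclideanSpace ℝ (Fin d) → EuclideanSpace ℝ (Fin n) → Ξ → EuclideanSpace ℝ (Fin d))
    (Gy : EuclideanSpace ℝ (Fin d) → EuclideanSpace ℝ (Fin n) → Ξ → EuclideanSpace ℝ (Fin n))
    (B₁ B₂ : ℝ) : Prop where
  isClosed_left : IsClosed X
  convex_left : Convex ℝ X
  isClosed_right : IsClosed Y
  convex_right : Convex ℝ Y
  oracle_left : IsSubGaussianOracle ν (X ×ˢ Y) (Function.uncurry Gx) B₁
  oracle_right : IsSubGaussianOracle ν (X ×ˢ Y) (Function.uncurry (-Gy)) B₂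

/-- The ghost iterates of the two players of one epoch: projected descent with half the step size
along the noise of the oracles at the iterates of the epoch. -/
noncomputable def ghostIterate (ν : Measure Ξ) (X : Set (EuclideanSpace ℝ (Fin d)))
    (Y : Set (EuclideanSpace ℝ (Fin n)))
    (Gx : EuclideanSpace ℝ (Fin d) → EuclideanSpace ℝ (Fin n) → Ξ → EuclideanSpace ℝ (Fin d))
    (Gy : EuclideanSpace ℝ (Fin d) → EuclideanSpace ℝ (Fin n) → Ξ → EuclideanSpace ℝ (Fin n))
    (p : EpochParams) (z₀ : EuclideanSpace ℝ (Fin d) × EuclideanSpace ℝ (Fin n)) (s : ℕ → Ξ)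
    (t : ℕ) : EuclideanSpace ℝ (Fin d) × EuclideanSpace ℝ (Fin n) :=
  let z := innerIterate X Y Gx Gy p z₀.1 z₀.2 s
  (projDescent (X ∩ Metric.closedBall z₀.1 p.R) (p.ηx / 2)
      (fun t => oracleNoise ν (Function.uncurry Gx) (z t) (s t)) z₀.1 t,
    projDescent (Y ∩ Metric.closedBall z₀.2 p.R) (p.ηy / 2)
      (fun t => oracleNoise ν (Function.uncurry (-Gy)) (z t) (s t)) z₀.2 t)

/-- The sum of the step errors of the two players in a step at the state `z`, where `v` is the
difference of the pair of iterates and the pair of ghost iterates. -/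
noncomputable def saddleStepError (ν : Measure Ξ)
    (Gx : EuclideanSpace ℝ (Fin d) → EuclideanSpace ℝ (Fin n) → Ξ → EuclideanSpace ℝ (Fin d))
    (Gy : EuclideanSpace ℝ (Fin d) → EuclideanSpace ℝ (Fin n) → Ξ → EuclideanSpace ℝ (Fin n))
    (B₁ B₂ : ℝ) (p : EpochParams) (z v : EuclideanSpace ℝ (Fin d) × EuclideanSpace ℝ (Fin n))
    (s : Ξ) : ℝ :=
  stepError ν (Function.uncurry Gx) p.ηx B₁ z v.1 s
    + stepError ν (Function.uncurry (-Gy)) p.ηy B₂ z v.2 s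

/-- The stochastic part of the regret of one epoch: the sum of the step errors of both players. -/
noncomputable def epochError (ν : Measure Ξ) (X : Set (EuclideanSpace ℝ (Fin d)))
    (Y : Set (EuclideanSpace ℝ (Fin n)))
    (Gx : EuclideanSpace ℝ (Fin d) → EuclideanSpace ℝ (Fin n) → Ξ → EuclideanSpace ℝ (Fin d))
    (Gy : EuclideanSpace ℝ (Fin d) → EuclideanSpace ℝ (Fin n) → Ξ → EuclideanSpace ℝ (Fin n))
    (B₁ B₂ : ℝ) (p : EpochParams) (z₀ : EuclideanSpace ℝ (Fin d) × EuclideanSpace ℝ (Fin n))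
    (s : ℕ → Ξ) : ℝ :=
  ∑ t ∈ Finset.range p.T,
    saddleStepError ν Gx Gy B₁ B₂ p (innerIterate X Y Gx Gy p z₀.1 z₀.2 s t)
      (innerIterate X Y Gx Gy p z₀.1 z₀.2 s t - ghostIterate ν X Y Gx Gy p z₀ s t) (s t)

namespace IsGDAOracle

theorem isClosed_inter_closedBall_left (h : IsGDAOracle ν X Y Gx Gy B₁ B₂)
    (c : EuclideanSpace ℝ (Fin d)) (R : ℝ) : IsClosed (X ∩ Metric.closedBall c R) :=
  h.isClosed_left.inter Metric.isClosed_closedBall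

theorem isClosed_inter_closedBall_right (h : IsGDAOracle ν X Y Gx Gy B₁ B₂)
    (c : EuclideanSpace ℝ (Fin n)) (R : ℝ) : IsClosed (Y ∩ Metric.closedBall c R) :=
  h.isClosed_right.inter Metric.isClosed_closedBall

theorem innerIterate_mem (h : IsGDAOracle ν X Y Gx Gy B₁ B₂) (hz₀ : z₀ ∈ X ×ˢ Y) (hR : 0 ≤ p.R)
    (s : ℕ → Ξ) (t : ℕ) :
    innerIterate X Y Gx Gy p z₀.1 z₀.2 s t ∈
      (X ∩ Metric.closedBall z₀.1 p.R) ×ˢ (Y ∩ Metric.closedBall z₀.2 p.R) := by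
  rw [innerIterate_eq_projDescent]
  exact ⟨projDescent_mem (h.isClosed_inter_closedBall_left _ _) _
      ⟨hz₀.1, Metric.mem_closedBall_self hR⟩ t,
    projDescent_mem (h.isClosed_inter_closedBall_right _ _) _
      ⟨hz₀.2, Metric.mem_closedBall_self hR⟩ t⟩

theorem innerIterate_mem_prod (h : IsGDAOracle ν X Y Gx Gy B₁ B₂) (hz₀ : z₀ ∈ X ×ˢ Y)
    (hR : 0 ≤ p.R) (s : ℕ → Ξ) (t : ℕ) : innerIterate X Y Gx Gy p z₀.1 z₀.2 s t ∈ X ×ˢ Y :=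
  Set.prod_mono Set.inter_subset_left Set.inter_subset_left (h.innerIterate_mem hz₀ hR s t)

theorem ghostIterate_mem (h : IsGDAOracle ν X Y Gx Gy B₁ B₂) (hz₀ : z₀ ∈ X ×ˢ Y) (hR : 0 ≤ p.R)
    (s : ℕ → Ξ) (t : ℕ) :
    ghostIterate ν X Y Gx Gy p z₀ s t ∈
      (X ∩ Metric.closedBall z₀.1 p.R) ×ˢ (Y ∩ Metric.closedBall z₀.2 p.R) :=
  ⟨projDescent_mem (h.isClosed_inter_closedBall_left _ _) _
      ⟨hz₀.1, Metric.mem_closedBall_self hR⟩ t,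
    projDescent_mem (h.isClosed_inter_closedBall_right _ _) _
      ⟨hz₀.2, Metric.mem_closedBall_self hR⟩ t⟩

theorem norm_innerIterate_sub_ghostIterate_le (h : IsGDAOracle ν X Y Gx Gy B₁ B₂)
    (hz₀ : z₀ ∈ X ×ˢ Y) (hR : 0 ≤ p.R) (s : ℕ → Ξ) (t : ℕ) :
    ‖innerIterate X Y Gx Gy p z₀.1 z₀.2 s t - ghostIterate ν X Y Gx Gy p z₀ s t‖ ≤ 2 * p.R := by
  have hz := h.innerIterate_mem hz₀ hR s t
  have hghost := h.ghostIterate_mem hz₀ hR s t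
  rw [← dist_eq_norm, two_mul]
  refine (dist_triangle_right _ _ z₀).trans (add_le_add ?_ ?_)
  · exact max_le hz.1.2 hz.2.2
  · exact max_le hghost.1.2 hghost.2.2

theorem epochAverage_mem (h : IsGDAOracle ν X Y Gx Gy B₁ B₂) (hz₀ : z₀ ∈ X ×ˢ Y) (hR : 0 ≤ p.R)
    (hT : 0 < p.T) (s : ℕ → Ξ) : epochAverage X Y Gx Gy p z₀.1 z₀.2 s ∈ X ×ˢ Y :=
  ⟨average_mem h.convex_left hT fun t => (h.innerIterate_mem_prod hz₀ hR s t).1,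
    average_mem h.convex_right hT fun t => (h.innerIterate_mem_prod hz₀ hR s t).2⟩

theorem epochGDA_mem (h : IsGDAOracle ν X Y Gx Gy B₁ B₂) (hz₀ : z₀ ∈ X ×ˢ Y)
    (hR : ∀ k, 0 ≤ (epochParams p k).R) (hT : ∀ k, 0 < (epochParams p k).T) (s : ℕ → ℕ → Ξ) :
    ∀ k, epochGDA X Y Gx Gy p z₀.1 z₀.2 s k ∈ X ×ˢ Y
  | 0 => hz₀
  | k + 1 => h.epochAverage_mem (h.epochGDA_mem hz₀ hR hT s k) (hR k) (hT k) (s k)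

section Measurability

variable {α : Type*} {mα : MeasurableSpace α}
  {c : α → EuclideanSpace ℝ (Fin d) × EuclideanSpace ℝ (Fin n)}

theorem measurable_innerIterate (h : IsGDAOracle ν X Y Gx Gy B₁ B₂) (hR : 0 < p.R)
    (hc : Measurable c) (hcXY : ∀ a, c a ∈ X ×ˢ Y) {s : ℕ → α → Ξ} (t : ℕ)
    (hs : ∀ i < t, Measurable (s i)) :
    Measurable fun a => innerIterate X Y Gx Gy p (c a).1 (c a).2 (fun i => s i a) t := by
  induction t using Nat.strong_induction_on with
  | _ t ih =>
    have hquery : ∀ i < t, Measurable fun a =>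
        (innerIterate X Y Gx Gy p (c a).1 (c a).2 (fun i => s i a) i, s i a) := fun i hi =>
      (ih i hi fun j hj => hs j (hj.trans hi)).prodMk (hs i hi)
    simp only [innerIterate_eq_projDescent _ _ t]
    exact (measurable_projDescent h.isClosed_left h.convex_left hR hc.fst (fun a => (hcXY a).1)
        fun i hi => h.oracle_left.measurable.comp (hquery i hi)).prodMk
      (measurable_projDescent h.isClosed_right h.convex_right hR hc.snd (fun a => (hcXY a).2)
        fun i hi => h.oracle_right.measurable.comp (hquery i hi))

theorem measurable_ghostIterate [IsProbabilityMeasure ν] (h : IsGDAOracle ν X Y Gx Gy B₁ B₂)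
    (hR : 0 < p.R) (hc : Measurable c) (hcXY : ∀ a, c a ∈ X ×ˢ Y) {s : ℕ → α → Ξ} (t : ℕ)
    (hs : ∀ i < t, Measurable (s i)) :
    Measurable fun a => ghostIterate ν X Y Gx Gy p (c a) (fun i => s i a) t := by
  have hquery : ∀ i < t, Measurable fun a =>
      (innerIterate X Y Gx Gy p (c a).1 (c a).2 (fun i => s i a) i, s i a) := fun i hi =>
    (h.measurable_innerIterate hR hc hcXY i fun j hj => hs j (hj.trans hi)).prodMk (hs i hi)
  exact (measurable_projDescent h.isClosed_left h.convex_left hR hc.fst (fun a => (hcXY a).1)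
      fun i hi => h.oracle_left.measurable_oracleNoise.comp (hquery i hi)).prodMk
    (measurable_projDescent h.isClosed_right h.convex_right hR hc.snd (fun a => (hcXY a).2)
      fun i hi => h.oracle_right.measurable_oracleNoise.comp (hquery i hi))

theorem measurable_epochAverage (h : IsGDAOracle ν X Y Gx Gy B₁ B₂) (hR : 0 < p.R)
    (hc : Measurable c) (hcXY : ∀ a, c a ∈ X ×ˢ Y) {s : ℕ → α → Ξ} (hs : ∀ t, Measurable (s t)) :
    Measurable fun a => epochAverage X Y Gx Gy p (c a).1 (c a).2 fun t => s t a := by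
  have hz : ∀ t, Measurable fun a =>
      innerIterate X Y Gx Gy p (c a).1 (c a).2 (fun i => s i a) t := fun t =>
    h.measurable_innerIterate hR hc hcXY t fun i _ => hs i
  have hfst := Finset.measurable_sum (Finset.range p.T) fun t _ => (hz t).fst
  have hsnd := Finset.measurable_sum (Finset.range p.T) fun t _ => (hz t).snd
  exact (hfst.const_smul (1 / (p.T : ℝ))).prodMk (hsnd.const_smul (1 / (p.T : ℝ)))

theorem measurable_epochGDA (h : IsGDAOracle ν X Y Gx Gy B₁ B₂) (hz₀ : z₀ ∈ X ×ˢ Y)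
    (hR : ∀ k, 0 < (epochParams p k).R) (hT : ∀ k, 0 < (epochParams p k).T)
    {s : ℕ → ℕ → α → Ξ} {k : ℕ} (hs : ∀ i < k, ∀ t, Measurable (s i t)) :
    Measurable fun a => epochGDA X Y Gx Gy p z₀.1 z₀.2 (fun i t => s i t a) k := by
  induction k with
  | zero => exact measurable_const
  | succ k ih =>
    exact h.measurable_epochAverage (hR k) (ih fun i hi => hs i (hi.trans k.lt_succ_self))
      (fun a => h.epochGDA_mem hz₀ (fun k => (hR k).le) hT _ k) (hs k k.lt_succ_self)

end Measurability

end IsGDAOracle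

end Iterates

section TunedParameters

variable {p : EpochParams} {m B₁ B₂ δ' : ℝ}

/-- The parameters of one epoch are tuned to the modulus `m`, the oracle constants `B₁`, `B₂` and
the failure probability `δ'`, as in the theorem: step sizes proportional to `R²`, and a length `T`
at least inversely proportional to `R²`. These proportionalities survive the passage to the next
epoch. -/
structure EpochParams.Tuned (p : EpochParams) (m B₁ B₂ δ' : ℝ) : Prop where
  m_pos : 0 < m
  B₁_pos : 0 < B₁
  B₂_pos : 0 < B₂
  δ'_pos : 0 < δ'
  δ'_lt_one : δ' < 1
  R_pos : 0 < p.R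
  ηx_eq : p.ηx = m * p.R ^ 2 / (40 * (5 + 3 * Real.log (1 / δ')) * B₁ ^ 2)
  ηy_eq : p.ηy = m * p.R ^ 2 / (40 * (5 + 3 * Real.log (1 / δ')) * B₂ ^ 2)
  epochConst_le : epochConst B₁ B₂ δ' ≤ p.T * (m ^ 2 * p.R ^ 2)

theorem EpochParams.next_R_sq (p : EpochParams) : p.next.R ^ 2 = p.R ^ 2 / 2 := by
  rw [EpochParams.next, div_pow, Real.sq_sqrt zero_le_two]

theorem epochParams_R_sq (p : EpochParams) (k : ℕ) : (epochParams p k).R ^ 2 = p.R ^ 2 / 2 ^ k := by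
  induction k with
  | zero => rw [epochParams, pow_zero, div_one]
  | succ k ih => rw [epochParams, EpochParams.next_R_sq, ih, div_div, pow_succ (2 : ℝ) k]

theorem three_div_two_mul_le {η m R c B T : ℝ} (hm : 0 < m) (hR : 0 < R) (hc : 0 < c) (hB : 0 < B)
    (hη : η = m * R ^ 2 / (40 * c * B ^ 2)) (hT : 3200 * c * B ^ 2 ≤ T * (m ^ 2 * R ^ 2)) :
    3 / (2 * η) ≤ T * (3 * m / 160) := by
  have hinv : 3 / (2 * η) = 3 / 160 * (3200 * c * B ^ 2) / (m * R ^ 2) := by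
    rw [hη]
    field_simp
    norm_num
  rw [hinv, div_le_iff₀ (by positivity)]
  linarith

namespace EpochParams.Tuned

theorem next (hp : p.Tuned m B₁ B₂ δ') : p.next.Tuned m B₁ B₂ δ' where
  __ := hp
  R_pos := div_pos hp.R_pos (by positivity)
  ηx_eq := by
    rw [p.next_R_sq, EpochParams.next, hp.ηx_eq]
    ring
  ηy_eq := by
    rw [p.next_R_sq, EpochParams.next, hp.ηy_eq]
    ring
  epochConst_le := by
    refine hp.epochConst_le.trans_eq ?_
    rw [p.next_R_sq, EpochParams.next]
    push_cast
    ring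

theorem iterate (hp : p.Tuned m B₁ B₂ δ') : ∀ k, (epochParams p k).Tuned m B₁ B₂ δ'
  | 0 => hp
  | k + 1 => (hp.iterate k).next

theorem log_pos (hp : p.Tuned m B₁ B₂ δ') : 0 < Real.log (1 / δ') :=
  Real.log_pos (one_lt_one_div hp.δ'_pos hp.δ'_lt_one)

theorem mul_log_le (hp : p.Tuned m B₁ B₂ δ') :
    307200 * ((B₁ + B₂) ^ 2 * Real.log (1 / δ')) ≤ p.T * (m ^ 2 * p.R ^ 2) := by
  have hle := (le_max_left _ _).trans hp.epochConst_le
  linarith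

theorem mul_max_sq_le (hp : p.Tuned m B₁ B₂ δ') :
    3200 * (5 + 3 * Real.log (1 / δ')) * max (B₁ ^ 2) (B₂ ^ 2) ≤ p.T * (m ^ 2 * p.R ^ 2) :=
  (le_max_right _ _).trans hp.epochConst_le

theorem T_pos (hp : p.Tuned m B₁ B₂ δ') : 0 < p.T := by
  have hlength := hp.mul_log_le
  have hL := hp.log_pos
  have hB₁ := hp.B₁_pos
  have hB₂ := hp.B₂_pos
  have hT : (0 : ℝ) < p.T :=
    pos_of_mul_pos_left ((by positivity : 0 < 307200 * ((B₁ + B₂) ^ 2 * Real.log (1 / δ'))).trans_le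
      hlength) (by positivity)
  exact_mod_cast hT

theorem three_div_two_mul_ηx_le (hp : p.Tuned m B₁ B₂ δ') :
    3 / (2 * p.ηx) ≤ p.T * (3 * m / 160) := by
  have hL := hp.log_pos
  refine three_div_two_mul_le hp.m_pos hp.R_pos (by positivity) hp.B₁_pos hp.ηx_eq
    (hp.mul_max_sq_le.trans' ?_)
  gcongr
  exact le_max_left _ _

theorem three_div_two_mul_ηy_le (hp : p.Tuned m B₁ B₂ δ') :
    3 / (2 * p.ηy) ≤ p.T * (3 * m / 160) := by
  have hL := hp.log_pos
  refine three_div_two_mul_le hp.m_pos hp.R_pos (by positivity) hp.B₂_pos hp.ηy_eq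
    (hp.mul_max_sq_le.trans' ?_)
  gcongr
  exact le_max_right _ _

theorem ηx_pos (hp : p.Tuned m B₁ B₂ δ') : 0 < p.ηx := by
  have hL := hp.log_pos
  have hm := hp.m_pos
  have hR := hp.R_pos
  have hB₁ := hp.B₁_pos
  rw [hp.ηx_eq]
  positivity

theorem ηy_pos (hp : p.Tuned m B₁ B₂ δ') : 0 < p.ηy := by
  have hL := hp.log_pos
  have hm := hp.m_pos
  have hR := hp.R_pos
  have hB₂ := hp.B₂_pos
  rw [hp.ηy_eq]
  positivity

theorem ηx_mul_sq (hp : p.Tuned m B₁ B₂ δ') :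
    p.ηx * B₁ ^ 2 = m * p.R ^ 2 / (40 * (5 + 3 * Real.log (1 / δ'))) := by
  rw [hp.ηx_eq, ← div_div, div_mul_cancel₀ _ (pow_ne_zero 2 hp.B₁_pos.ne')]

theorem ηy_mul_sq (hp : p.Tuned m B₁ B₂ δ') :
    p.ηy * B₂ ^ 2 = m * p.R ^ 2 / (40 * (5 + 3 * Real.log (1 / δ'))) := by
  rw [hp.ηy_eq, ← div_div, div_mul_cancel₀ _ (pow_ne_zero 2 hp.B₂_pos.ne')]

theorem drift_le (hp : p.Tuned m B₁ B₂ δ') :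
    3 * (m * p.R ^ 2 / (40 * (5 + 3 * Real.log (1 / δ'))))
      + 12 * (40 * Real.log (1 / δ') / (p.T * (m * p.R ^ 2))) * (2 * p.R * (B₁ + B₂)) ^ 2
      ≤ 17 / 800 * (m * p.R ^ 2) := by
  have hL := hp.log_pos
  have hm := hp.m_pos
  have hR := hp.R_pos
  have hT : (0 : ℝ) < p.T := Nat.cast_pos.2 hp.T_pos
  have hsteps : m * p.R ^ 2 / (40 * (5 + 3 * Real.log (1 / δ'))) ≤ m * p.R ^ 2 / 200 := by
    gcongr
    linarith
  have hvariance : 12 * (40 * Real.log (1 / δ') / (p.T * (m * p.R ^ 2)))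
      * (2 * p.R * (B₁ + B₂)) ^ 2 ≤ m * p.R ^ 2 / 160 := by
    calc 12 * (40 * Real.log (1 / δ') / (p.T * (m * p.R ^ 2))) * (2 * p.R * (B₁ + B₂)) ^ 2
        = 307200 * ((B₁ + B₂) ^ 2 * Real.log (1 / δ')) / (160 * (p.T * m)) := by
          field_simp
          ring
      _ ≤ p.T * (m ^ 2 * p.R ^ 2) / (160 * (p.T * m)) :=
          div_le_div_of_nonneg_right hp.mul_log_le (by positivity)
      _ = m * p.R ^ 2 / 160 := by field_simp
  linarith

end EpochParams.Tuned

end TunedParameters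

section EpochError

variable {Ω Ξ : Type*} [MeasurableSpace Ξ] {ν : Measure Ξ} [IsProbabilityMeasure ν] {d n : ℕ}
  {X : Set (EuclideanSpace ℝ (Fin d))} {Y : Set (EuclideanSpace ℝ (Fin n))}
  {Gx : EuclideanSpace ℝ (Fin d) → EuclideanSpace ℝ (Fin n) → Ξ → EuclideanSpace ℝ (Fin d)}
  {Gy : EuclideanSpace ℝ (Fin d) → EuclideanSpace ℝ (Fin n) → Ξ → EuclideanSpace ℝ (Fin n)}
  {B₁ B₂ m δ' : ℝ} {p : EpochParams} {mΩ : MeasurableSpace Ω} {P : Measure Ω}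
  [IsProbabilityMeasure P] {𝓕 : ℕ → MeasurableSpace Ω} {ξ : ℕ → Ω → Ξ}
  {z₀ : Ω → EuclideanSpace ℝ (Fin d) × EuclideanSpace ℝ (Fin n)}

theorem IsGDAOracle.measurable_saddleStepError (h : IsGDAOracle ν X Y Gx Gy B₁ B₂) :
    Measurable fun q : ((EuclideanSpace ℝ (Fin d) × EuclideanSpace ℝ (Fin n)) ×
        (EuclideanSpace ℝ (Fin d) × EuclideanSpace ℝ (Fin n))) × Ξ =>
      saddleStepError ν Gx Gy B₁ B₂ p q.1.1 q.1.2 q.2 := by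
  have hleft := h.oracle_left.measurable_stepError (η := p.ηx)
  have hright := h.oracle_right.measurable_stepError (η := p.ηy)
  have hquery_left : Measurable fun q : ((EuclideanSpace ℝ (Fin d) × EuclideanSpace ℝ (Fin n)) ×
      (EuclideanSpace ℝ (Fin d) × EuclideanSpace ℝ (Fin n))) × Ξ =>
      ((q.1.1, q.1.2.1), q.2) := by fun_prop
  have hquery_right : Measurable fun q : ((EuclideanSpace ℝ (Fin d) × EuclideanSpace ℝ (Fin n)) ×
      (EuclideanSpace ℝ (Fin d) × EuclideanSpace ℝ (Fin n))) × Ξ =>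
      ((q.1.1, q.1.2.2), q.2) := by fun_prop
  have hsum := (hleft.comp hquery_left).add (hright.comp hquery_right)
  exact hsum

theorem IsGDAOracle.isLogEValue_epochError (h : IsGDAOracle ν X Y Gx Gy B₁ B₂)
    (h𝓕 : ∀ t, 𝓕 t ≤ mΩ) (hmono : Monotone 𝓕) (hξ : ∀ t, Measurable[𝓕 (t + 1)] (ξ t))
    (hlaw : ∀ t, P.map (ξ t) = ν)
    (hind : ∀ t, Indep (𝓕 t) (MeasurableSpace.comap (ξ t) inferInstance) P)
    (hz₀ : Measurable[𝓕 0] z₀) (hz₀XY : ∀ ω, z₀ ω ∈ X ×ˢ Y) (hR : 0 < p.R) {a κ : ℝ}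
    (hηx : p.ηx * B₁ ^ 2 = a) (hηy : p.ηy * B₂ ^ 2 = a) (ha : 0 ≤ a) (hκ : 0 ≤ κ)
    (hκa : κ * a ≤ 1 / 3) :
    IsLogEValue P fun ω => κ * (epochError ν X Y Gx Gy B₁ B₂ p (z₀ ω) (fun t => ξ t ω)
      - p.T * (3 * a + 12 * κ * (2 * p.R * (B₁ + B₂)) ^ 2)) := by
  have hpast : ∀ t, ∀ i < t, Measurable[𝓕 t] (ξ i) := fun t i hi =>
    (hξ i).mono (hmono hi) le_rfl
  have hstart : ∀ t, Measurable[𝓕 t] z₀ := fun t => hz₀.mono (hmono t.zero_le) le_rfl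
  have hz : ∀ t, Measurable[𝓕 t] fun ω =>
      innerIterate X Y Gx Gy p (z₀ ω).1 (z₀ ω).2 (fun i => ξ i ω) t := fun t =>
    h.measurable_innerIterate hR (hstart t) hz₀XY t (hpast t)
  have hghost : ∀ t, Measurable[𝓕 t] fun ω =>
      ghostIterate ν X Y Gx Gy p (z₀ ω) (fun i => ξ i ω) t := fun t =>
    h.measurable_ghostIterate hR (hstart t) hz₀XY t (hpast t)
  have hstep : Measurable (Function.uncurry fun
      (q : (EuclideanSpace ℝ (Fin d) × EuclideanSpace ℝ (Fin n)) ×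
        (EuclideanSpace ℝ (Fin d) × EuclideanSpace ℝ (Fin n))) (s : Ξ) =>
      κ * (saddleStepError ν Gx Gy B₁ B₂ p q.1 q.2 s
        - (3 * a + 12 * κ * (2 * p.R * (B₁ + B₂)) ^ 2))) :=
    (h.measurable_saddleStepError.sub_const _).const_mul κ
  have hstate : ∀ t, Measurable[𝓕 t] fun ω =>
      (innerIterate X Y Gx Gy p (z₀ ω).1 (z₀ ω).2 (fun i => ξ i ω) t,
        innerIterate X Y Gx Gy p (z₀ ω).1 (z₀ ω).2 (fun i => ξ i ω) t
          - ghostIterate ν X Y Gx Gy p (z₀ ω) (fun i => ξ i ω) t) := fun t =>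
    (hz t).prodMk ((hz t).sub (hghost t))
  have hevalue : ∀ t ω, IsLogEValue ν fun s => κ * (saddleStepError ν Gx Gy B₁ B₂ p
        (innerIterate X Y Gx Gy p (z₀ ω).1 (z₀ ω).2 (fun i => ξ i ω) t)
        (innerIterate X Y Gx Gy p (z₀ ω).1 (z₀ ω).2 (fun i => ξ i ω) t
          - ghostIterate ν X Y Gx Gy p (z₀ ω) (fun i => ξ i ω) t) s
      - (3 * a + 12 * κ * (2 * p.R * (B₁ + B₂)) ^ 2)) := fun t ω => by
    have hv := h.norm_innerIterate_sub_ghostIterate_le (hz₀XY ω) hR.le (ξ · ω) t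
    exact h.oracle_left.isLogEValue_stepError_add h.oracle_right
      (h.innerIterate_mem_prod (hz₀XY ω) hR.le (ξ · ω) t) (by positivity)
      ((norm_fst_le _).trans hv) ((norm_snd_le _).trans hv) hηx hηy ha hκ hκa
  have hsum := isLogEValue_sum_of_indep h𝓕 hmono hξ hlaw hind hstep hstate hevalue p.T
  simp only [← Finset.mul_sum, Finset.sum_sub_distrib, Finset.sum_const, Finset.card_range,
    nsmul_eq_mul] at hsum
  exact hsum

theorem IsGDAOracle.measureReal_lt_epochError_le (h : IsGDAOracle ν X Y Gx Gy B₁ B₂)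
    (h𝓕 : ∀ t, 𝓕 t ≤ mΩ) (hmono : Monotone 𝓕) (hξ : ∀ t, Measurable[𝓕 (t + 1)] (ξ t))
    (hlaw : ∀ t, P.map (ξ t) = ν)
    (hind : ∀ t, Indep (𝓕 t) (MeasurableSpace.comap (ξ t) inferInstance) P)
    (hz₀ : Measurable[𝓕 0] z₀) (hz₀XY : ∀ ω, z₀ ω ∈ X ×ˢ Y) (hp : p.Tuned m B₁ B₂ δ') :
    P.real {ω | p.T * (37 / 800 * (m * p.R ^ 2))
      < epochError ν X Y Gx Gy B₁ B₂ p (z₀ ω) (fun t => ξ t ω)} ≤ δ' := by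
  have hL := hp.log_pos
  have hm := hp.m_pos
  have hR := hp.R_pos
  have hT : (1 : ℝ) ≤ p.T := Nat.one_le_cast.2 hp.T_pos
  set L := Real.log (1 / δ') with hL_def
  set κ := 40 * L / (p.T * (m * p.R ^ 2)) with hκ
  set a := m * p.R ^ 2 / (40 * (5 + 3 * L)) with ha
  have hκa : κ * a ≤ 1 / 3 := by
    calc κ * a = L / (p.T * (5 + 3 * L)) := by
          rw [hκ, ha]
          field_simp
      _ ≤ L / (1 * (3 * L)) := by
          gcongr
          linarith
      _ = 1 / 3 := by field_simp
  have hevalue := h.isLogEValue_epochError h𝓕 hmono hξ hlaw hind hz₀ hz₀XY hR hp.ηx_mul_sq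
    hp.ηy_mul_sq (by positivity) (by positivity) hκa
  have hexp : Real.exp (-L) = δ' := by
    rw [hL_def, one_div, Real.log_inv, neg_neg, Real.exp_log hp.δ'_pos]
  refine (measureReal_mono fun ω hω => ?_).trans ((hevalue.measureReal_lt_le L).trans_eq hexp)
  rw [Set.mem_ofPred_eq] at hω ⊢
  calc L = κ * (p.T * (37 / 800 * (m * p.R ^ 2)) - p.T * (17 / 800 * (m * p.R ^ 2))) := by
        rw [hκ]
        field_simp
        norm_num
    _ ≤ κ * (p.T * (37 / 800 * (m * p.R ^ 2))
          - p.T * (3 * a + 12 * κ * (2 * p.R * (B₁ + B₂)) ^ 2)) := by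
        gcongr
        exact hp.drift_le
    _ < κ * (epochError ν X Y Gx Gy B₁ B₂ p (z₀ ω) (fun t => ξ t ω)
          - p.T * (3 * a + 12 * κ * (2 * p.R * (B₁ + B₂)) ^ 2)) := by
        gcongr

end EpochError

section Regret

variable {Ξ : Type*} [MeasurableSpace Ξ] {ν : Measure Ξ} {d n : ℕ}
  {X : Set (EuclideanSpace ℝ (Fin d))} {Y : Set (EuclideanSpace ℝ (Fin n))}
  {f : EuclideanSpace ℝ (Fin d) → EuclideanSpace ℝ (Fin n) → ℝ}
  {Gx : EuclideanSpace ℝ (Fin d) → EuclideanSpace ℝ (Fin n) → Ξ → EuclideanSpace ℝ (Fin d)}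
  {Gy : EuclideanSpace ℝ (Fin d) → EuclideanSpace ℝ (Fin n) → Ξ → EuclideanSpace ℝ (Fin n)}
  {B₁ B₂ m δ' : ℝ} {p : EpochParams}
  {z₀ : EuclideanSpace ℝ (Fin d) × EuclideanSpace ℝ (Fin n)}
  {a : EuclideanSpace ℝ (Fin d)} {b : EuclideanSpace ℝ (Fin n)}

/-- The means of the oracles `Gx` and `-Gy` are subgradients of `f` in `x` and of `-f` in `y`. -/
structure IsMeanSubgradient (ν : Measure Ξ) (X : Set (EuclideanSpace ℝ (Fin d)))
    (Y : Set (EuclideanSpace ℝ (Fin n)))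
    (f : EuclideanSpace ℝ (Fin d) → EuclideanSpace ℝ (Fin n) → ℝ)
    (Gx : EuclideanSpace ℝ (Fin d) → EuclideanSpace ℝ (Fin n) → Ξ → EuclideanSpace ℝ (Fin d))
    (Gy : EuclideanSpace ℝ (Fin d) → EuclideanSpace ℝ (Fin n) → Ξ → EuclideanSpace ℝ (Fin n)) :
    Prop where
  isSubgradientOn_left : ∀ z ∈ X ×ˢ Y,
    IsSubgradientOn X (fun x => f x z.2) z.1 (∫ s, Function.uncurry Gx z s ∂ν)
  isSubgradientOn_right : ∀ z ∈ X ×ˢ Y,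
    IsSubgradientOn Y (fun y => -f z.1 y) z.2 (∫ s, Function.uncurry (-Gy) z s ∂ν)

namespace IsGDAOracle

variable [IsProbabilityMeasure ν]

theorem mul_sub_epochAverage_le (h : IsGDAOracle ν X Y Gx Gy B₁ B₂)
    (hG : IsMeanSubgradient ν X Y f Gx Gy) (hηx : 0 < p.ηx) (hηy : 0 < p.ηy) (hR : 0 ≤ p.R)
    (hT : 0 < p.T) (hz₀ : z₀ ∈ X ×ˢ Y) (hfx : ConvexOn ℝ X (fun x => f x b))
    (hfy : ConvexOn ℝ Y (fun y => -f a y)) (ha : a ∈ X ∩ Metric.closedBall z₀.1 p.R)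
    (hb : b ∈ Y ∩ Metric.closedBall z₀.2 p.R) (s : ℕ → Ξ) :
    p.T * (f (epochAverage X Y Gx Gy p z₀.1 z₀.2 s).1 b
        - f a (epochAverage X Y Gx Gy p z₀.1 z₀.2 s).2) ≤
      3 / (2 * p.ηx) * ‖z₀.1 - a‖ ^ 2 + 3 / (2 * p.ηy) * ‖z₀.2 - b‖ ^ 2
        + epochError ν X Y Gx Gy B₁ B₂ p z₀ s := by
  set z := innerIterate X Y Gx Gy p z₀.1 z₀.2 s with hz
  have hzXY : ∀ t, z t ∈ X ×ˢ Y := h.innerIterate_mem_prod hz₀ hR s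
  have hjensen := mul_sub_average_le hT hfx hfy (fun t => (hzXY t).1) (fun t => (hzXY t).2) ha.1
    hb.1 (fun t => hG.isSubgradientOn_left _ (hzXY t))
    (fun t => hG.isSubgradientOn_right _ (hzXY t))
  have hleft := sum_inner_projDescent_le_of_estimate (h.isClosed_inter_closedBall_left z₀.1 p.R)
    (h.convex_left.inter (convex_closedBall _ _)) hηx (fun t => Function.uncurry Gx (z t) (s t))
    (fun t => ∫ s', Function.uncurry Gx (z t) s' ∂ν)
    (fun t => h.oracle_left.norm_integral_le (hzXY t)) z₀.1 ha p.T
  have hright := sum_inner_projDescent_le_of_estimate (h.isClosed_inter_closedBall_right z₀.2 p.R)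
    (h.convex_right.inter (convex_closedBall _ _)) hηy
    (fun t => Function.uncurry (-Gy) (z t) (s t))
    (fun t => ∫ s', Function.uncurry (-Gy) (z t) s' ∂ν)
    (fun t => h.oracle_right.norm_integral_le (hzXY t)) z₀.2 hb p.T
  have hz_eq : ∀ t, z t = (_, _) := innerIterate_eq_projDescent z₀ s
  simp only [← hz, Prod.ext_iff] at hz_eq
  simp only [← (hz_eq _).1] at hleft
  simp only [← (hz_eq _).2] at hright
  have herror : epochError ν X Y Gx Gy B₁ B₂ p z₀ s = _ := Finset.sum_add_distrib
  rw [herror]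
  refine hjensen.trans ((add_le_add hleft hright).trans_eq ?_)
  rw [add_add_add_comm]
  rfl

theorem dualityGap_epochAverage_le (h : IsGDAOracle ν X Y Gx Gy B₁ B₂)
    (hG : IsMeanSubgradient ν X Y f Gx Gy) (hf : IsStronglyConvexConcave X Y f m)
    (hp : p.Tuned m B₁ B₂ δ') (hz₀ : z₀ ∈ X ×ˢ Y)
    (hgap : dualityGap X Y f z₀.1 z₀.2 ≤ m * p.R ^ 2 / 8) {s : ℕ → Ξ}
    (herror : epochError ν X Y Gx Gy B₁ B₂ p z₀ s ≤ p.T * (37 / 800 * (m * p.R ^ 2))) :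
    dualityGap X Y f (epochAverage X Y Gx Gy p z₀.1 z₀.2 s).1
      (epochAverage X Y Gx Gy p z₀.1 z₀.2 s).2 ≤ m * p.R ^ 2 / 16 := by
  have hmem := h.epochAverage_mem hz₀ hp.R_pos.le hp.T_pos s
  refine hf.dualityGap_le_of_forall_sub_le hz₀.1 hz₀.2 hp.R_pos hgap hmem.1 hmem.2
    fun a ha b hb => ?_
  have hregret := h.mul_sub_epochAverage_le hG hp.ηx_pos hp.ηy_pos hp.R_pos.le hp.T_pos hz₀
    (convexOn_of_strongConvexOn hf.pos.le (hf.strongConvexOn_left b hb.1))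
    (convexOn_of_strongConvexOn hf.pos.le (hf.strongConvexOn_right a ha.1)) ha hb s
  have hleft := mul_le_mul_of_nonneg_right hp.three_div_two_mul_ηx_le (sq_nonneg ‖z₀.1 - a‖)
  have hright := mul_le_mul_of_nonneg_right hp.three_div_two_mul_ηy_le (sq_nonneg ‖z₀.2 - b‖)
  rw [norm_sub_rev a, norm_sub_rev b]
  refine le_of_mul_le_mul_left ?_ (Nat.cast_pos (α := ℝ) |>.2 hp.T_pos)
  linarith

theorem dualityGap_epochGDA_le (h : IsGDAOracle ν X Y Gx Gy B₁ B₂)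
    (hG : IsMeanSubgradient ν X Y f Gx Gy) (hf : IsStronglyConvexConcave X Y f m)
    (hp : p.Tuned m B₁ B₂ δ') (hz₀ : z₀ ∈ X ×ˢ Y)
    (hgap : dualityGap X Y f z₀.1 z₀.2 ≤ m * p.R ^ 2 / 8) {s : ℕ → ℕ → Ξ} {K : ℕ}
    (herror : ∀ k < K,
      epochError ν X Y Gx Gy B₁ B₂ (epochParams p k) (epochGDA X Y Gx Gy p z₀.1 z₀.2 s k) (s k) ≤
        (epochParams p k).T * (37 / 800 * (m * (epochParams p k).R ^ 2))) :
    dualityGap X Y f (epochGDA X Y Gx Gy p z₀.1 z₀.2 s K).1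
      (epochGDA X Y Gx Gy p z₀.1 z₀.2 s K).2 ≤ m * (epochParams p K).R ^ 2 / 8 := by
  induction K with
  | zero => exact hgap
  | succ K ih =>
    have hmem := h.epochGDA_mem hz₀ (fun k => (hp.iterate k).R_pos.le)
      (fun k => (hp.iterate k).T_pos) s K
    have hepoch := h.dualityGap_epochAverage_le hG hf (hp.iterate K) hmem
      (ih fun k hk => herror k (hk.trans K.lt_succ_self)) (herror K K.lt_succ_self)
    refine hepoch.trans_eq ?_
    rw [epochParams, EpochParams.next_R_sq]
    ring

end IsGDAOracle

end Regret

section HighProbability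

theorem one_sub_mul_le_measureReal_forall_le {Ω : Type*} [MeasurableSpace Ω] {P : Measure Ω}
    [IsProbabilityMeasure P] {A : ℕ → Ω → ℝ} {c : ℕ → ℝ} {δ : ℝ} (K : ℕ)
    (hA : ∀ k < K, P.real {ω | c k < A k ω} ≤ δ) :
    1 - K * δ ≤ P.real {ω | ∀ k < K, A k ω ≤ c k} := by
  have hbad : P.real (⋃ k ∈ Finset.range K, {ω | c k < A k ω}) ≤ K * δ := by
    refine (measureReal_biUnion_finset_le _ _).trans ?_
    refine (Finset.sum_le_sum fun k hk => hA k (Finset.mem_range.1 hk)).trans_eq ?_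
    rw [Finset.sum_const, Finset.card_range, nsmul_eq_mul]
  have hcover : Set.univ ⊆
      {ω | ∀ k < K, A k ω ≤ c k} ∪ ⋃ k ∈ Finset.range K, {ω | c k < A k ω} := by
    intro ω _
    simp only [Set.mem_union, Set.mem_ofPred_eq, Set.mem_iUnion, Finset.mem_range, exists_prop]
    by_contra! hω
    obtain ⟨⟨k, hk, hlt⟩, hle⟩ := hω
    exact (hle k hk).not_gt hlt
  have hunion := (measureReal_mono hcover).trans (measureReal_union_le (μ := P) _ _)
  rw [probReal_univ] at hunion
  linarith

variable {Ω Ξ : Type*} [MeasurableSpace Ξ] {ν : Measure Ξ} [IsProbabilityMeasure ν] {d n : ℕ}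
  {X : Set (EuclideanSpace ℝ (Fin d))} {Y : Set (EuclideanSpace ℝ (Fin n))}
  {f : EuclideanSpace ℝ (Fin d) → EuclideanSpace ℝ (Fin n) → ℝ}
  {Gx : EuclideanSpace ℝ (Fin d) → EuclideanSpace ℝ (Fin n) → Ξ → EuclideanSpace ℝ (Fin d)}
  {Gy : EuclideanSpace ℝ (Fin d) → EuclideanSpace ℝ (Fin n) → Ξ → EuclideanSpace ℝ (Fin n)}
  {B₁ B₂ m δ' : ℝ} {p : EpochParams}
  {z₀ : EuclideanSpace ℝ (Fin d) × EuclideanSpace ℝ (Fin n)}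
  [MeasurableSpace Ω] {P : Measure Ω} [IsProbabilityMeasure P] {ξ : ℕ → ℕ → Ω → Ξ}

theorem IsGDAOracle.one_sub_le_measureReal_dualityGap_le (h : IsGDAOracle ν X Y Gx Gy B₁ B₂)
    (hG : IsMeanSubgradient ν X Y f Gx Gy) (hf : IsStronglyConvexConcave X Y f m)
    (hp : p.Tuned m B₁ B₂ δ') (hz₀ : z₀ ∈ X ×ˢ Y)
    (hgap : dualityGap X Y f z₀.1 z₀.2 ≤ m * p.R ^ 2 / 8) (hξ : ∀ k t, Measurable (ξ k t))
    (hlaw : ∀ k t, P.map (ξ k t) = ν) (hind : iIndepFun (fun i : ℕ × ℕ => ξ i.1 i.2) P) (K : ℕ) :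
    1 - K * δ' ≤ P.real {ω |
      dualityGap X Y f (epochGDA X Y Gx Gy p z₀.1 z₀.2 (fun k t => ξ k t ω) K).1
        (epochGDA X Y Gx Gy p z₀.1 z₀.2 (fun k t => ξ k t ω) K).2
        ≤ m * (epochParams p K).R ^ 2 / 8} := by
  have hR := fun k => (hp.iterate k).R_pos
  have hT := fun k => (hp.iterate k).T_pos
  have herror := fun k => h.measureReal_lt_epochError_le (pastSamples_le hξ k)
    (pastSamples_mono ξ k) (fun t => measurable_pastSamples ξ (.inr ⟨rfl, t.lt_succ_self⟩))
    (hlaw k) (indep_pastSamples hξ hind k)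
    (h.measurable_epochGDA hz₀ hR hT fun i hi t => measurable_pastSamples ξ (.inl hi))
    (fun ω => h.epochGDA_mem hz₀ (fun k => (hR k).le) hT (fun k t => ξ k t ω) k) (hp.iterate k)
  exact (one_sub_mul_le_measureReal_forall_le K fun k _ => herror k).trans
    (measureReal_mono fun ω hω => h.dualityGap_epochGDA_le hG hf hp hz₀ hgap hω)

end HighProbability

section IterationCount

variable {p : EpochParams} {K : ℕ} {B₁ B₂ m N δ' ε₀ ε q : ℝ}

theorem epochParams_T (p : EpochParams) (k : ℕ) : (epochParams p k).T = 2 ^ k * p.T := by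
  induction k with
  | zero => rw [epochParams, pow_zero, one_mul]
  | succ k ih => rw [epochParams, EpochParams.next, ih, pow_succ', mul_assoc]

theorem totalIterations_eq (p : EpochParams) (K : ℕ) :
    (totalIterations p K : ℝ) = (2 ^ K - 1) * p.T := by
  simp only [totalIterations, epochParams_T, ← Finset.sum_mul, Nat.cast_mul, Nat.cast_sum,
    Nat.cast_pow, Nat.cast_ofNat]
  rw [geom_sum_eq (by norm_num)]
  norm_num

theorem le_two_pow_ceil_logb (hq : 0 < q) : q ≤ 2 ^ ⌈Real.logb 2 q⌉₊ := by
  rw [← Real.rpow_natCast, ← Real.logb_le_iff_le_rpow one_lt_two hq]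
  exact Nat.le_ceil _

theorem two_pow_ceil_logb_le (hq : 1 ≤ q) : (2 : ℝ) ^ ⌈Real.logb 2 q⌉₊ ≤ 2 * q := by
  have hceil := (Nat.ceil_lt_add_one (Real.logb_nonneg one_lt_two hq)).le
  calc (2 : ℝ) ^ ⌈Real.logb 2 q⌉₊ = 2 ^ (⌈Real.logb 2 q⌉₊ : ℝ) := (Real.rpow_natCast _ _).symm
    _ ≤ 2 ^ (Real.logb 2 q + 1) := Real.rpow_le_rpow_of_exponent_le one_le_two hceil
    _ = 2 * q := by
      rw [Real.rpow_add two_pos, Real.rpow_logb two_pos (by norm_num) (one_pos.trans_le hq),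
        Real.rpow_one, mul_comm]

theorem mul_two_mul_sqrt_sq (hm : 0 < m) (hε₀ : 0 ≤ ε₀) :
    m * (2 * √(2 * ε₀ / m)) ^ 2 = 8 * ε₀ := by
  rw [mul_pow, Real.sq_sqrt (by positivity)]
  field_simp
  ring

theorem eight_mul_le_mul_sq (hm : 0 < m) (hε₀ : 0 ≤ ε₀) (hR : 2 * √(2 * ε₀ / m) ≤ p.R) :
    8 * ε₀ ≤ m * p.R ^ 2 := by
  rw [← mul_two_mul_sqrt_sq hm hε₀]
  gcongr

theorem mul_epochParams_R_sq_le (hm : 0 ≤ m) (hε₀ : 0 < ε₀) (hε : 0 < ε) (hK : ε₀ / ε ≤ 2 ^ K) :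
    m * (epochParams p K).R ^ 2 / 8 ≤ m * p.R ^ 2 / (8 * ε₀) * ε := by
  rw [epochParams_R_sq]
  calc m * (p.R ^ 2 / 2 ^ K) / 8 ≤ m * (p.R ^ 2 / (ε₀ / ε)) / 8 := by gcongr
    _ = m * p.R ^ 2 / (8 * ε₀) * ε := by field_simp

theorem totalIterations_le (hm : 0 < m) (hε₀ : 0 < ε₀) (hε : 0 < ε) (hN : 0 ≤ N)
    (hR : 8 * ε₀ ≤ m * p.R ^ 2) (hK : 2 ^ K ≤ 2 * (ε₀ / ε)) :
    (totalIterations p K : ℝ) ≤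
      N / (4 * m * ε) + (p.T - N / (m ^ 2 * p.R ^ 2)) * (2 * ε₀ / ε) := by
  have htotal : (totalIterations p K : ℝ) ≤ p.T * (2 * ε₀ / ε) := by
    rw [totalIterations_eq, mul_comm, mul_div_assoc]
    gcongr
    linarith
  have hmin : N / (m ^ 2 * p.R ^ 2) * (2 * ε₀ / ε) ≤ N / (4 * m * ε) :=
    calc N / (m ^ 2 * p.R ^ 2) * (2 * ε₀ / ε) = N / (m * (m * p.R ^ 2)) * (2 * ε₀ / ε) := by ring
      _ ≤ N / (m * (8 * ε₀)) * (2 * ε₀ / ε) := by gcongr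
      _ = N / (4 * m * ε) := by field_simp; ring
  linarith

theorem totalIterations_le_of_T_eq_ceil (hm : 0 < m) (hε₀ : 0 < ε₀) (hε : 0 < ε) (hN : 0 ≤ N)
    (hR : 8 * ε₀ ≤ m * p.R ^ 2) (hK : 2 ^ K ≤ 2 * (ε₀ / ε))
    (hT : p.T = ⌈N / (m ^ 2 * p.R ^ 2)⌉₊) :
    (totalIterations p K : ℝ) ≤ N / (4 * m * ε) + 2 * ε₀ / ε := by
  refine (totalIterations_le hm hε₀ hε hN hR hK).trans ?_
  have hround : (p.T : ℝ) - N / (m ^ 2 * p.R ^ 2) ≤ 1 := by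
    rw [hT, sub_le_iff_le_add']
    exact (Nat.ceil_lt_add_one (by positivity)).le
  gcongr
  exact mul_le_of_le_one_left (by positivity) hround

theorem epochConst_nonneg (hL : 0 ≤ Real.log (1 / δ')) : 0 ≤ epochConst B₁ B₂ δ' :=
  le_max_of_le_left (by positivity)

theorem epochConst_le (hB₁ : 0 ≤ B₁) (hB₂ : 0 ≤ B₂) (hL : 0 ≤ Real.log (1 / δ')) :
    epochConst B₁ B₂ δ' ≤ (16000 + 307200 * Real.log (1 / δ')) * (B₁ + B₂) ^ 2 := by
  have hmax : max (B₁ ^ 2) (B₂ ^ 2) ≤ (B₁ + B₂) ^ 2 := max_le (by gcongr; linarith)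
    (by gcongr; linarith)
  refine max_le (by nlinarith [sq_nonneg (B₁ + B₂)]) ?_
  calc 3200 * (5 + 3 * Real.log (1 / δ')) * max (B₁ ^ 2) (B₂ ^ 2)
      ≤ 3200 * (5 + 3 * Real.log (1 / δ')) * (B₁ + B₂) ^ 2 := by gcongr
    _ ≤ (16000 + 307200 * Real.log (1 / δ')) * (B₁ + B₂) ^ 2 := by gcongr; linarith

theorem epochConst_div_add_le (hm : 0 < m) (hε : 0 < ε) (hB₁ : 0 ≤ B₁) (hB₂ : 0 ≤ B₂)
    (hL : 0 ≤ Real.log (1 / δ')) (hε₀ : ε₀ ≤ (B₁ + B₂) ^ 2 / m) :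
    epochConst B₁ B₂ δ' / (4 * m * ε) + 2 * ε₀ / ε ≤
      10 ^ 5 * (1 + Real.log (1 / δ')) * (B₁ + B₂) ^ 2 / (m * ε) :=
  calc epochConst B₁ B₂ δ' / (4 * m * ε) + 2 * ε₀ / ε
      ≤ (16000 + 307200 * Real.log (1 / δ')) * (B₁ + B₂) ^ 2 / (4 * m * ε)
        + 2 * ((B₁ + B₂) ^ 2 / m) / ε := by gcongr; exact epochConst_le hB₁ hB₂ hL
    _ = (4002 + 76800 * Real.log (1 / δ')) * (B₁ + B₂) ^ 2 / (m * ε) := by field_simp; ring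
    _ ≤ 10 ^ 5 * (1 + Real.log (1 / δ')) * (B₁ + B₂) ^ 2 / (m * ε) := by gcongr; linarith

end IterationCount

section Theorem

variable {Ξ : Type*} [MeasurableSpace Ξ] {ν : Measure Ξ} {d n : ℕ}
  {X : Set (EuclideanSpace ℝ (Fin d))} {Y : Set (EuclideanSpace ℝ (Fin n))}
  {f : EuclideanSpace ℝ (Fin d) → EuclideanSpace ℝ (Fin n) → ℝ}
  {Gx : EuclideanSpace ℝ (Fin d) → EuclideanSpace ℝ (Fin n) → Ξ → EuclideanSpace ℝ (Fin d)}
  {Gy : EuclideanSpace ℝ (Fin d) → EuclideanSpace ℝ (Fin n) → Ξ → EuclideanSpace ℝ (Fin n)}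
  {B B₁ B₂ m : ℝ}

theorem subGaussianNorm_neg {V : Ξ → EuclideanSpace ℝ (Fin d)} :
    SubGaussianNorm ν (-V) B ↔ SubGaussianNorm ν V B := by
  simp only [SubGaussianNorm, Pi.neg_apply, norm_neg]

theorem isSubgradientOn_neg {S : Set (EuclideanSpace ℝ (Fin d))}
    {g : EuclideanSpace ℝ (Fin d) → ℝ} {x v : EuclideanSpace ℝ (Fin d)} :
    IsSubgradientOn S (fun z => -g z) x (-v) ↔ IsSupergradientOn S g x v := by
  refine forall₂_congr fun z _ => ?_
  rw [inner_neg_left, ← neg_add, neg_le_neg_iff]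

theorem isGDAOracle_of_subGaussianNorm (hXclosed : IsClosed X) (hXconv : Convex ℝ X)
    (hYclosed : IsClosed Y) (hYconv : Convex ℝ Y)
    (hGxm : Measurable fun q : EuclideanSpace ℝ (Fin d) × EuclideanSpace ℝ (Fin n) × Ξ =>
      Gx q.1 q.2.1 q.2.2)
    (hGym : Measurable fun q : EuclideanSpace ℝ (Fin d) × EuclideanSpace ℝ (Fin n) × Ξ =>
      Gy q.1 q.2.1 q.2.2)
    (hB₁ : 0 < B₁) (hB₂ : 0 < B₂)
    (hGxB : ∀ x ∈ X, ∀ y ∈ Y, SubGaussianNorm ν (Gx x y) B₁)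
    (hGyB : ∀ x ∈ X, ∀ y ∈ Y, SubGaussianNorm ν (Gy x y) B₂) :
    IsGDAOracle ν X Y Gx Gy B₁ B₂ where
  isClosed_left := hXclosed
  convex_left := hXconv
  isClosed_right := hYclosed
  convex_right := hYconv
  oracle_left :=
    { pos := hB₁
      measurable := hGxm.comp MeasurableEquiv.prodAssoc.measurable
      subGaussianNorm := fun z hz => hGxB z.1 hz.1 z.2 hz.2 }
  oracle_right :=
    { pos := hB₂
      measurable := hGym.neg.comp MeasurableEquiv.prodAssoc.measurable
      subGaussianNorm := fun z hz => subGaussianNorm_neg.2 (hGyB z.1 hz.1 z.2 hz.2) }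

theorem isMeanSubgradient_of_isSupergradientOn
    (hGx : ∀ x ∈ X, ∀ y ∈ Y, IsSubgradientOn X (fun x' => f x' y) x (∫ s, Gx x y s ∂ν))
    (hGy : ∀ x ∈ X, ∀ y ∈ Y, IsSupergradientOn Y (fun y' => f x y') y (∫ s, Gy x y s ∂ν)) :
    IsMeanSubgradient ν X Y f Gx Gy where
  isSubgradientOn_left z hz := hGx z.1 hz.1 z.2 hz.2
  isSubgradientOn_right z hz := by
    have hneg : ∫ s, Function.uncurry (-Gy) z s ∂ν = -∫ s, Gy z.1 z.2 s ∂ν :=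
      integral_neg (Gy z.1 z.2)
    rw [hneg]
    exact isSubgradientOn_neg.2 (hGy z.1 hz.1 z.2 hz.2)

theorem IsMeanSubgradient.isStronglyConvexConcave (hG : IsMeanSubgradient ν X Y f Gx Gy)
    (hm : 0 < m) (hX : IsClosed X) (hY : IsClosed Y)
    (hfx : ∀ y ∈ Y, StrongConvexOn X m (fun x => f x y))
    (hfy : ∀ x ∈ X, StrongConcaveOn Y m (fun y => f x y)) :
    IsStronglyConvexConcave X Y f m where
  pos := hm
  isClosed_left := hX
  isClosed_right := hY
  strongConvexOn_left := hfx
  strongConvexOn_right x hx := (hfy x hx).neg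
  subdifferentiableOn_left y hy x hx := ⟨_, hG.isSubgradientOn_left (x, y) ⟨hx, hy⟩⟩
  subdifferentiableOn_right x hx y hy := ⟨_, hG.isSubgradientOn_right (x, y) ⟨hx, hy⟩⟩

end Theorem

theorem theorem1_general {d n : ℕ}
    {X : Set (EuclideanSpace ℝ (Fin d))} {Y : Set (EuclideanSpace ℝ (Fin n))}
    (hXclosed : IsClosed X) (hYclosed : IsClosed Y)
    {f : EuclideanSpace ℝ (Fin d) → EuclideanSpace ℝ (Fin n) → ℝ}
    {m : ℝ} (hm : 0 < m)
    (hfx : ∀ y ∈ Y, StrongConvexOn X m (fun x => f x y))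
    (hfy : ∀ x ∈ X, StrongConcaveOn Y m (fun y => f x y))
    {x₀ : EuclideanSpace ℝ (Fin d)} {y₀ : EuclideanSpace ℝ (Fin n)} (hx₀ : x₀ ∈ X) (hy₀ : y₀ ∈ Y)
    {ε₀ : ℝ} (hε₀ : 0 < ε₀) (hgap : dualityGap X Y f x₀ y₀ ≤ ε₀)
    {Ξ : Type*} [MeasurableSpace Ξ] {ν : Measure Ξ} [IsProbabilityMeasure ν]
    {Gx : EuclideanSpace ℝ (Fin d) → EuclideanSpace ℝ (Fin n) → Ξ → EuclideanSpace ℝ (Fin d)}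
    {Gy : EuclideanSpace ℝ (Fin d) → EuclideanSpace ℝ (Fin n) → Ξ → EuclideanSpace ℝ (Fin n)}
    (hGxm : Measurable fun q : EuclideanSpace ℝ (Fin d) × EuclideanSpace ℝ (Fin n) × Ξ =>
      Gx q.1 q.2.1 q.2.2)
    (hGym : Measurable fun q : EuclideanSpace ℝ (Fin d) × EuclideanSpace ℝ (Fin n) × Ξ =>
      Gy q.1 q.2.1 q.2.2)
    (hGx : ∀ x ∈ X, ∀ y ∈ Y, IsSubgradientOn X (fun x' => f x' y) x (∫ s, Gx x y s ∂ν))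
    (hGy : ∀ x ∈ X, ∀ y ∈ Y, IsSupergradientOn Y (fun y' => f x y') y (∫ s, Gy x y s ∂ν))
    {B₁ B₂ : ℝ} (hB₁ : 0 < B₁) (hB₂ : 0 < B₂)
    (hGxB : ∀ x ∈ X, ∀ y ∈ Y, SubGaussianNorm ν (Gx x y) B₁)
    (hGyB : ∀ x ∈ X, ∀ y ∈ Y, SubGaussianNorm ν (Gy x y) B₂)
    {Ω : Type*} [MeasurableSpace Ω] {P : Measure Ω} [IsProbabilityMeasure P]
    {ξ : ℕ → ℕ → Ω → Ξ} (hξm : ∀ k t, Measurable (ξ k t))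
    (hξlaw : ∀ k t, P.map (ξ k t) = ν)
    (hξindep : iIndepFun (fun i : ℕ × ℕ => ξ i.1 i.2) P)
    {δ ε : ℝ} (hδ0 : 0 < δ) (hδ1 : δ < 1) (hε0 : 0 < ε) (hε : ε < ε₀)
    {K : ℕ} (hK : K = ⌈Real.logb 2 (ε₀ / ε)⌉₊)
    {δ' : ℝ} (hδ' : δ' = δ / K)
    {p : EpochParams}
    (hR : 2 * Real.sqrt (2 * ε₀ / m) ≤ p.R)
    (hηx : p.ηx = m * p.R ^ 2 / (40 * (5 + 3 * Real.log (1 / δ')) * B₁ ^ 2))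
    (hηy : p.ηy = m * p.R ^ 2 / (40 * (5 + 3 * Real.log (1 / δ')) * B₂ ^ 2))
    (hT : epochConst B₁ B₂ δ' / (m ^ 2 * p.R ^ 2) ≤ (p.T : ℝ)) :
    (1 - δ ≤ P.real {ω |
        dualityGap X Y f (epochGDA X Y Gx Gy p x₀ y₀ (fun k t => ξ k t ω) K).1
          (epochGDA X Y Gx Gy p x₀ y₀ (fun k t => ξ k t ω) K).2
          ≤ m * p.R ^ 2 / (8 * ε₀) * ε}) ∧
    (p.R = 2 * Real.sqrt (2 * ε₀ / m) →
      1 - δ ≤ P.real {ω |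
        dualityGap X Y f (epochGDA X Y Gx Gy p x₀ y₀ (fun k t => ξ k t ω) K).1
          (epochGDA X Y Gx Gy p x₀ y₀ (fun k t => ξ k t ω) K).2 ≤ ε}) ∧
    ((totalIterations p K : ℝ) ≤ epochConst B₁ B₂ δ' / (4 * m * ε)
        + ((p.T : ℝ) - epochConst B₁ B₂ δ' / (m ^ 2 * p.R ^ 2)) * (2 * ε₀ / ε)) ∧
    (p.T = ⌈epochConst B₁ B₂ δ' / (m ^ 2 * p.R ^ 2)⌉₊ →
      (totalIterations p K : ℝ) ≤ epochConst B₁ B₂ δ' / (4 * m * ε) + 2 * ε₀ / ε) ∧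
    (p.T = ⌈epochConst B₁ B₂ δ' / (m ^ 2 * p.R ^ 2)⌉₊ → ε₀ ≤ (B₁ + B₂) ^ 2 / m →
      (totalIterations p K : ℝ) ≤ 10 ^ 5 * (1 + Real.log (K / δ)) * (B₁ + B₂) ^ 2 / (m * ε)) := by
  have hq : 1 < ε₀ / ε := (one_lt_div hε0).2 hε
  have hK1 : 1 ≤ K := hK ▸ Nat.one_le_ceil_iff.2 (Real.logb_pos one_lt_two hq)
  have hle2K : ε₀ / ε ≤ 2 ^ K := hK ▸ le_two_pow_ceil_logb (one_pos.trans hq)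
  have h2K : 2 ^ K ≤ 2 * (ε₀ / ε) := hK ▸ two_pow_ceil_logb_le hq.le
  have hδ'0 : 0 < δ' := hδ' ▸ by positivity
  have hδ'1 : δ' < 1 := hδ' ▸ (div_le_self hδ0.le (Nat.one_le_cast.2 hK1)).trans_lt hδ1
  have hRpos : 0 < p.R := hR.trans_lt' (by positivity)
  have hmR := eight_mul_le_mul_sq hm hε₀.le hR
  have hp : p.Tuned m B₁ B₂ δ' := ⟨hm, hB₁, hB₂, hδ'0, hδ'1, hRpos, hηx, hηy,
    (div_le_iff₀ (by positivity)).1 hT⟩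
  have horacle := isGDAOracle_of_subGaussianNorm hXclosed (hfx y₀ hy₀).1 hYclosed (hfy x₀ hx₀).1
    hGxm hGym hB₁ hB₂ hGxB hGyB
  have hG := isMeanSubgradient_of_isSupergradientOn hGx hGy
  have hsaddle := hG.isStronglyConvexConcave hm hXclosed hYclosed hfx hfy
  have hN := epochConst_nonneg (B₁ := B₁) (B₂ := B₂) hp.log_pos.le
  have hKδ : K * δ' = δ := by rw [hδ', mul_div_cancel₀ _ (by positivity)]
  have hgap₀ : dualityGap X Y f x₀ y₀ ≤ m * p.R ^ 2 / 8 := by linarith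
  have hprob := hKδ ▸ (horacle.one_sub_le_measureReal_dualityGap_le (z₀ := (x₀, y₀)) hG hsaddle hp
    ⟨hx₀, hy₀⟩ hgap₀ hξm hξlaw hξindep K).trans (measureReal_mono fun ω hω =>
      le_trans hω (mul_epochParams_R_sq_le hm.le hε₀ hε0 hle2K))
  refine ⟨hprob, fun hReq => ?_, totalIterations_le hm hε₀ hε0 hN hmR h2K,
    totalIterations_le_of_T_eq_ceil hm hε₀ hε0 hN hmR h2K, fun hTeq hε₀B => ?_⟩
  · rwa [hReq, mul_two_mul_sqrt_sq hm hε₀.le, div_self (by positivity), one_mul] at hprob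
  · refine (totalIterations_le_of_T_eq_ceil hm hε₀ hε0 hN hmR h2K hTeq).trans ?_
    rw [← one_div_div δ, ← hδ']
    exact epochConst_div_add_le hm hε0 hB₁.le hB₂.le hp.log_pos.le hε₀B

theorem theorem1 {d n : ℕ}
    -- the min-max problem
    (X : Set (EuclideanSpace ℝ (Fin d))) (Y : Set (EuclideanSpace ℝ (Fin n)))
    (hXclosed : IsClosed X) (hXconv : Convex ℝ X)
    (hYclosed : IsClosed Y) (hYconv : Convex ℝ Y)
    (f : EuclideanSpace ℝ (Fin d) → EuclideanSpace ℝ (Fin n) → ℝ)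
    (hf : ContinuousOn (fun p : EuclideanSpace ℝ (Fin d) × EuclideanSpace ℝ (Fin n) => f p.1 p.2)
      (X ×ˢ Y))
    (μ lam : ℝ) (hμ : 0 < μ) (hlam : 0 < lam)
    (hfx : ∀ y ∈ Y, StrongConvexOn X μ (fun x => f x y))
    (hfy : ∀ x ∈ X, StrongConcaveOn Y lam (fun y => f x y))
    -- the initial point
    (x₀ : EuclideanSpace ℝ (Fin d)) (y₀ : EuclideanSpace ℝ (Fin n)) (hx₀ : x₀ ∈ X) (hy₀ : y₀ ∈ Y)
    (ε₀ : ℝ) (hε₀ : 0 < ε₀) (hgap : dualityGap X Y f x₀ y₀ ≤ ε₀)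
    -- stochastic subgradients, `ν` being the law of a sample
    {Ξ : Type*} [MeasurableSpace Ξ] (ν : Measure Ξ) [IsProbabilityMeasure ν]
    (Gx : EuclideanSpace ℝ (Fin d) → EuclideanSpace ℝ (Fin n) → Ξ → EuclideanSpace ℝ (Fin d))
    (Gy : EuclideanSpace ℝ (Fin d) → EuclideanSpace ℝ (Fin n) → Ξ → EuclideanSpace ℝ (Fin n))
    (hGxm : Measurable fun q : EuclideanSpace ℝ (Fin d) × EuclideanSpace ℝ (Fin n) × Ξ =>
      Gx q.1 q.2.1 q.2.2)
    (hGym : Measurable fun q : EuclideanSpace ℝ (Fin d) × EuclideanSpace ℝ (Fin n) × Ξ =>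
      Gy q.1 q.2.1 q.2.2)
    (hGx : ∀ x ∈ X, ∀ y ∈ Y, IsSubgradientOn X (fun x' => f x' y) x (∫ s, Gx x y s ∂ν))
    (hGy : ∀ x ∈ X, ∀ y ∈ Y, IsSupergradientOn Y (fun y' => f x y') y (∫ s, Gy x y s ∂ν))
    (B₁ B₂ : ℝ) (hB₁ : 0 < B₁) (hB₂ : 0 < B₂)
    (hGxB : ∀ x ∈ X, ∀ y ∈ Y, SubGaussianNorm ν (Gx x y) B₁)
    (hGyB : ∀ x ∈ X, ∀ y ∈ Y, SubGaussianNorm ν (Gy x y) B₂)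
    -- independent samples: `ξ k t` is used at step `t` of epoch `k + 1`
    {Ω : Type*} [MeasurableSpace Ω] (P : Measure Ω) [IsProbabilityMeasure P]
    (ξ : ℕ → ℕ → Ω → Ξ) (hξm : ∀ k t, Measurable (ξ k t))
    (hξlaw : ∀ k t, P.map (ξ k t) = ν)
    (hξindep : iIndepFun (fun i : ℕ × ℕ => ξ i.1 i.2) P)
    -- failure probability, accuracy, number of epochs and initial parameters
    (δ ε : ℝ) (hδ0 : 0 < δ) (hδ1 : δ < 1) (hε0 : 0 < ε) (hε1 : ε < 1) (hε : ε < ε₀)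
    (K : ℕ) (hK : K = ⌈Real.logb 2 (ε₀ / ε)⌉₊)
    (δ' : ℝ) (hδ' : δ' = δ / K)
    (m : ℝ) (hm : m = min μ lam)
    (p : EpochParams)
    (hR : 2 * Real.sqrt (2 * ε₀ / m) ≤ p.R)
    (hηx : p.ηx = m * p.R ^ 2 / (40 * (5 + 3 * Real.log (1 / δ')) * B₁ ^ 2))
    (hηy : p.ηy = m * p.R ^ 2 / (40 * (5 + 3 * Real.log (1 / δ')) * B₂ ^ 2))
    (hT : epochConst B₁ B₂ δ' / (m ^ 2 * p.R ^ 2) ≤ (p.T : ℝ)) :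
    -- accuracy reached after `K` epochs
    (1 - δ ≤ P.real {ω |
        dualityGap X Y f (epochGDA X Y Gx Gy p x₀ y₀ (fun k t => ξ k t ω) K).1
          (epochGDA X Y Gx Gy p x₀ y₀ (fun k t => ξ k t ω) K).2
          ≤ m * p.R ^ 2 / (8 * ε₀) * ε}) ∧
    (p.R = 2 * Real.sqrt (2 * ε₀ / m) →
      1 - δ ≤ P.real {ω |
        dualityGap X Y f (epochGDA X Y Gx Gy p x₀ y₀ (fun k t => ξ k t ω) K).1
          (epochGDA X Y Gx Gy p x₀ y₀ (fun k t => ξ k t ω) K).2 ≤ ε}) ∧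
    -- total number of iterations
    ((totalIterations p K : ℝ) ≤ epochConst B₁ B₂ δ' / (4 * m * ε)
        + ((p.T : ℝ) - epochConst B₁ B₂ δ' / (m ^ 2 * p.R ^ 2)) * (2 * ε₀ / ε)) ∧
    (p.T = ⌈epochConst B₁ B₂ δ' / (m ^ 2 * p.R ^ 2)⌉₊ →
      (totalIterations p K : ℝ) ≤ epochConst B₁ B₂ δ' / (4 * m * ε) + 2 * ε₀ / ε) ∧
    (p.T = ⌈epochConst B₁ B₂ δ' / (m ^ 2 * p.R ^ 2)⌉₊ → ε₀ ≤ (B₁ + B₂) ^ 2 / m →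
      (totalIterations p K : ℝ) ≤ 10 ^ 5 * (1 + Real.log (K / δ)) * (B₁ + B₂) ^ 2 / (m * ε)) := by
  subst hm
  exact theorem1_general hXclosed hYclosed (lt_min hμ hlam)
    (fun y hy => (hfx y hy).mono (min_le_left _ _)) (fun x hx => (hfy x hx).mono (min_le_right _ _))
    hx₀ hy₀ hε₀ hgap hGxm hGym hGx hGy hB₁ hB₂ hGxB hGyB hξm hξlaw hξindep hδ0 hδ1 hε0 hε hK hδ'
    hR hηx hηy hT
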